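/- Let $G(n,p)$ be the binomial random graph on the vertex set $\{1,\dots,n\}$, in which every pair of vertices is adjacent independently with probability $p$. For graphs $F$ and $G$, a spanning subgraph $H\subseteq G$ is called $F$-saturated in $G$ if it is inclusion-maximal among the spanning subgraphs of $G$ that contain no copy of $F$ as a (not necessarily induced) subgraph; $\mathrm{sat}(G,F)$ denotes the minimum number of edges of an $F$-saturated graph in $G$. A property holds with high probability if its probability tends to $1$ as $n\to\infty$. Let $C_m$ be the simple cycle on $m$ vertices. Theorem. Let $p\in(0,1)$ and an integer $m\ge 5$ be fixed. There are (non-random) sequences $\delta_1(n)\to 0$ and $\delta_2(n)\to 0$ as $n\to\infty$ such that, with high probability, $$ n+\frac{n}{4(m-1)\log_{1/(1-p)} n}\,(1-\delta_1(n))\;\le\;\mathrm{sat}(G(n,p),C_m)\;\le\; n+\frac{n}{2\log_{1/(1-p)} n}\,(1+\delta_2(n)). $$ Consequently, there are constants $c,C>0$, depending only on $p$ and $m$, such that, with high probability, $$ n+c\,\frac{n}{\ln n}\;\le\;\mathrm{sat}(G(n,p),C_m)\;\le\; n+C\,\frac{n}{\ln n}, $$ that is, $\mathrm{sat}(G(n,p),C_m)=n+\Theta(n/\ln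 n)$ with high probability. -/

import Mathlib

open Filter Topology MeasureTheory

namespace RandomCycleSaturation

/-- `H` is `F`-saturated in `G`: it is inclusion-maximal among the spanning subgraphs of `G` that
contain no (not necessarily induced) copy of `F`. -/
def IsSaturatedIn {U V : Type*} (F : SimpleGraph U) (G H : SimpleGraph V) : Prop :=
  Maximal (fun K : SimpleGraph V => K ≤ G ∧ F.Free K) H

/-- The saturation number `sat(G, F)`: the minimum number of edges of an `F`-saturated graph
in `G`. -/
noncomputable def sat {U V : Type*} (G : SimpleGraph V) (F : SimpleGraph U) : ℕ :=
  sInf {k : ℕ | ∃ H : SimpleGraph V, IsSaturatedIn F G H ∧ H.edgeSet.ncard = k}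

/-- The minimum that defines `sat(G, F)` is attained as soon as `F` has an edge. -/
theorem exists_isSaturatedIn_ncard_eq_sat {U V : Type*} [Finite V] (F : SimpleGraph U)
    (hF : F ≠ ⊥) (G : SimpleGraph V) :
    ∃ H : SimpleGraph V, IsSaturatedIn F G H ∧ H.edgeSet.ncard = sat G F := by
  have hfin : {K : SimpleGraph V | K ≤ G ∧ F.Free K}.Finite := Set.toFinite _
  obtain ⟨H, hH⟩ := hfin.exists_maximal ⟨⊥, bot_le, SimpleGraph.free_bot hF⟩
  exact Nat.sInf_mem (s := {k : ℕ | ∃ H : SimpleGraph V, IsSaturatedIn F G H ∧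
    H.edgeSet.ncard = k}) ⟨_, H, hH, rfl⟩

/-- The property `Q` holds with high probability for the binomial random graph `G(n, p)`:
its probability tends to `1` as `n → ∞`. -/
def Whp (p : unitInterval) (Q : ∀ n : ℕ, SimpleGraph (Fin n) → Prop) : Prop :=
  Tendsto (fun n : ℕ => SimpleGraph.binomialRandom (Fin n) p {G | Q n G}) atTop (𝓝 1)

end RandomCycleSaturation

/-!
Write `q = 1 - p` and `L = log_{1/q} n`.

**Lower bound.** Let `H` be `C_m`-saturated in `G`. Every edge of `G` that is missing from `H` is
bridged by a path with `m - 1` edges of `H` (`IsSaturatedIn.exists_isPath`). If `H` has `O(n)` edges,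
then all vertices are within distance `j = ⌊(m - 1) / 2⌋` of a set `R` of `O(n / L⁴)` vertices
(`exists_dominating`): take the vertices of degree above `L⁴` and, around `O(L)` vertices far from
these, balls of polylogarithmic size; the bridging path between such a vertex and a neighbour in `G`
meets the ball in its middle. Grow a breadth-first forest from `R` and let `k` be the number of
edges of `H` outside it, so that `H` has `n - |R| + k` edges. The core consists of `R`, the children
of roots, and the forest paths from the ends of the `k` surplus edges to the roots; it has about
`2 * j * k ≤ (m - 1) * k` vertices. Everything else hangs below the core in trees of depth less than
`j`. A path with `m - 1` edges does not fit into such a tree, so each of its two parity classes is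
independent in `G`, and it has at most `2 * α(G) ≈ 4 * L` vertices (`card_le_of_dominated`). Hence
`n ≤ (1 + o(1)) * (m - 1) * k * 4 * L`, which bounds `k` from below.

**Upper bound.** Take a clique `Q` on `m - 2` vertices, two vertices `c₁`, `c₂` of it, and a set `A`
of common neighbours of `c₁` and `c₂`, the hubs. Join all hubs to `c₁` and `c₂`, and every other
vertex to a single hub, such that the vertices at one hub are independent in `G`. The result is
`C_m`-saturated and has at most `n + |A| + m²` edges (`HubSystem.isSaturatedIn`,
`HubSystem.sat_le`). Greedily, most hubs serve independent sets of nearly maximal size `2 * L`, so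
that `(1 + o(1)) * n / (2 * L)` hubs suffice; the few vertices left over receive hubs of their own
(`sat_le_of_expansion`).

**The random graph.** What is used of `G(n, p)` are edges between any two sets of size `3 * L`, the
independence number, common neighbourhoods of bounded sets, and independent sets of size
`(2 - η) * L` in all sets of size `n / L⁵`. The last two follow from Janson's inequality
(`janson_lower_tail`), applied to the random set of edges and of non-edges respectively. Each bound
is obtained with an arbitrary fixed relative error `ε`; a diagonal argument
(`exists_tendsto_zero_whp`) turns `ε` into a sequence that tends to zero.
-/

namespace RandomCycleSaturation

open Finset

/-! ### Random subsets of a finite set -/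

section Bernoulli

variable {ι : Type*} [Fintype ι] [DecidableEq ι]

/-- The expectation of `f` at a random subset of `ι` that contains every element independently
with probability `θ`, written as a finite weighted sum. -/
noncomputable def bernoulliMean (θ : ℝ) (f : Finset ι → ℝ) : ℝ :=
  ∑ s : Finset ι, θ ^ #s * (1 - θ) ^ #sᶜ * f s

theorem bernoulliMean_one (θ : ℝ) : bernoulliMean θ (fun _ : Finset ι => 1) = 1 := by
  have := Fintype.sum_pow_mul_eq_add_pow ι θ (1 - θ)
  simp only [bernoulliMean, mul_one, card_compl]
  rw [this]; simp

theorem bernoulliMean_mono {θ : ℝ} (h0 : 0 ≤ θ) (h1 : θ ≤ 1) {f g : Finset ι → ℝ}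
    (h : ∀ s, f s ≤ g s) : bernoulliMean θ f ≤ bernoulliMean θ g := by
  have : 0 ≤ 1 - θ := by linarith
  unfold bernoulliMean
  gcongr with s
  exact h s

theorem bernoulliMean_nonneg {θ : ℝ} (h0 : 0 ≤ θ) (h1 : θ ≤ 1) {f : Finset ι → ℝ}
    (h : ∀ s, 0 ≤ f s) : 0 ≤ bernoulliMean θ f := by
  simpa [bernoulliMean] using bernoulliMean_mono h0 h1 (f := fun _ => 0) h

theorem bernoulliMean_sum {κ : Type*} (θ : ℝ) (T : Finset κ) (f : κ → Finset ι → ℝ) :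
    bernoulliMean θ (fun s => ∑ a ∈ T, f a s) = ∑ a ∈ T, bernoulliMean θ (f a) := by
  unfold bernoulliMean
  rw [sum_comm]
  simp [mul_sum]

theorem bernoulliMean_sub (θ : ℝ) (f g : Finset ι → ℝ) :
    bernoulliMean θ (fun s => f s - g s) = bernoulliMean θ f - bernoulliMean θ g := by
  simp [bernoulliMean, mul_sub]

theorem bernoulliMean_const_mul (θ c : ℝ) (f : Finset ι → ℝ) :
    bernoulliMean θ (fun s => c * f s) = c * bernoulliMean θ f := by
  simp only [bernoulliMean, mul_sum]
  exact sum_congr rfl fun s _ => by ring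

/-- Conditioning on `i ∈ s` amounts to inserting `i` into the random set. -/
theorem bernoulliMean_ite_mem (θ : ℝ) (i : ι) (h : Finset ι → ℝ) :
    bernoulliMean θ (fun s => if i ∈ s then h s else 0) =
      θ * bernoulliMean θ (fun s => h (insert i s)) := by
  have key : ∀ g : Finset ι → ℝ, ∑ s : Finset ι, g s =
      ∑ s ∈ (univ.erase i).powerset, (g s + g (insert i s)) := by
    intro g
    rw [sum_add_distrib, ← sum_powerset_insert (notMem_erase i univ), insert_erase (mem_univ i),
      powerset_univ]
  simp only [bernoulliMean]
  rw [key, key, mul_sum]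
  refine sum_congr rfl fun s hs => ?_
  have his : i ∉ s := fun hi => by simpa using mem_powerset.1 hs hi
  have hc : #sᶜ = #(insert i s)ᶜ + 1 := by
    have h1 := card_compl_add_card s
    have h2 := card_compl_add_card (insert i s)
    rw [card_insert_of_notMem his] at h2
    omega
  rw [hc, card_insert_of_notMem his]
  simp only [his, if_false, mem_insert_self, if_true, insert_idem]
  ring

/-- Conditioning on `F ⊆ s` amounts to adding `F` to the random set. -/
theorem bernoulliMean_ite_subset (θ : ℝ) (F : Finset ι) (h : Finset ι → ℝ) :
    bernoulliMean θ (fun s => if F ⊆ s then h s else 0) =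
      θ ^ #F * bernoulliMean θ (fun s => h (s ∪ F)) := by
  induction F using Finset.induction_on generalizing h with
  | empty => simp
  | insert i F hi ih =>
    have h1 : (fun s => if insert i F ⊆ s then h s else 0) =
        fun s => if i ∈ s then (if F ⊆ s then h s else 0) else 0 := by
      ext s
      by_cases h1 : i ∈ s <;> simp [insert_subset_iff, h1]
    have h2 : ∀ s : Finset ι, F ⊆ insert i s ↔ F ⊆ s := fun s => subset_insert_iff_of_notMem hi
    rw [h1, bernoulliMean_ite_mem]
    simp only [h2]
    rw [ih (fun s => h (insert i s)), card_insert_of_notMem hi]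
    simp only [union_insert]
    ring

theorem bernoulliMean_subset (θ : ℝ) (F : Finset ι) :
    bernoulliMean θ (fun s => if F ⊆ s then 1 else 0) = θ ^ #F := by
  rw [bernoulliMean_ite_subset, bernoulliMean_one, mul_one]

end Bernoulli

section HitCount

variable {ι κ : Type*} [DecidableEq ι]

/-- The number of sets of the family `F` that lie in `s`. -/
def hitCount (T : Finset κ) (F : κ → Finset ι) (s : Finset ι) : ℝ :=
  ∑ a ∈ T, if F a ⊆ s then 1 else 0

theorem hitCount_nonneg (T : Finset κ) (F : κ → Finset ι) (s : Finset ι) :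
    0 ≤ hitCount T F s := sum_nonneg fun a _ => by split_ifs <;> norm_num

theorem hitCount_mono (T : Finset κ) (F : κ → Finset ι) {s s' : Finset ι} (h : s ⊆ s') :
    hitCount T F s ≤ hitCount T F s' := by
  refine sum_le_sum fun a _ => ?_
  split_ifs with h1 h2
  · rfl
  · exact absurd (h1.trans h) h2
  · norm_num
  · rfl

end HitCount

/-! ### Janson's inequality -/

section Janson

variable {ι κ : Type*} [Fintype ι] [DecidableEq ι]

/-- The key estimate behind Janson's inequality: the part of `E[X e^{-tX}]` that comes from the
indicator of `F a`. The members of the family that are disjoint from `F a` are independent of it,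
the others are controlled to first order. -/
theorem le_bernoulliMean_exp_hitCount {θ t : ℝ} (h0 : 0 ≤ θ) (h1 : θ ≤ 1) (ht : 0 ≤ t)
    (T : Finset κ) (F : κ → Finset ι) (a : κ) :
    (θ ^ #(F a) - t * ∑ b ∈ T with ¬ Disjoint (F a) (F b), θ ^ #(F a ∪ F b)) *
        bernoulliMean θ (fun s => Real.exp (-t * hitCount T F s)) ≤
      bernoulliMean θ (fun s => if F a ⊆ s then Real.exp (-t * hitCount T F s) else 0) := by
  set Y := hitCount (T.filter fun b => ¬ Disjoint (F a) (F b)) F with hY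
  set Z := hitCount (T.filter fun b => Disjoint (F a) (F b)) F with hZ
  have hX : ∀ s, hitCount T F s = Z s + Y s := fun s => by
    simp only [hitCount, hY, hZ]
    exact (sum_filter_add_sum_filter_not _ _ _).symm
  set c := θ ^ #(F a) - t * ∑ b ∈ T with ¬ Disjoint (F a) (F b), θ ^ #(F a ∪ F b) with hc
  have hΨ : 0 ≤ bernoulliMean θ (fun s => Real.exp (-t * hitCount T F s)) :=
    bernoulliMean_nonneg h0 h1 fun s => (Real.exp_pos _).le
  rcases le_total c 0 with hneg | hpos
  · exact (mul_nonpos_of_nonpos_of_nonneg hneg hΨ).trans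
      (bernoulliMean_nonneg h0 h1 fun s => by split_ifs <;> positivity)
  have hZle : bernoulliMean θ (fun s => Real.exp (-t * hitCount T F s)) ≤
      bernoulliMean θ (fun s => Real.exp (-t * Z s)) := by
    refine bernoulliMean_mono h0 h1 fun s => Real.exp_le_exp.2 ?_
    have : 0 ≤ Y s := hitCount_nonneg _ _ _
    rw [hX]; nlinarith
  refine (mul_le_mul_of_nonneg_left hZle hpos).trans ?_
  have hZF : ∀ s, Z (s ∪ F a) = Z s := fun s => by
    simp only [hZ, hitCount]
    refine sum_congr rfl fun b hb => ?_
    have hd := (mem_filter.1 hb).2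
    have : F b ⊆ s ∪ F a ↔ F b ⊆ s :=
      ⟨fun h => (hd.symm.left_le_of_le_sup_right h), fun h => h.trans subset_union_left⟩
    simp [this]
  have e1 : θ ^ #(F a) * bernoulliMean θ (fun s => Real.exp (-t * Z s)) =
      bernoulliMean θ (fun s => if F a ⊆ s then Real.exp (-t * Z s) else 0) := by
    rw [bernoulliMean_ite_subset]; simp only [hZF]
  have e2 : ∀ b, bernoulliMean θ
      (fun s => if F a ∪ F b ⊆ s then Real.exp (-t * Z s) else 0) ≤
      θ ^ #(F a ∪ F b) * bernoulliMean θ (fun s => Real.exp (-t * Z s)) := fun b => by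
    rw [bernoulliMean_ite_subset]
    refine mul_le_mul_of_nonneg_left ?_ (pow_nonneg h0 _)
    refine bernoulliMean_mono h0 h1 fun s => Real.exp_le_exp.2 ?_
    have : Z s ≤ Z (s ∪ (F a ∪ F b)) := hitCount_mono _ _ subset_union_left
    nlinarith
  calc c * bernoulliMean θ (fun s => Real.exp (-t * Z s))
      = θ ^ #(F a) * bernoulliMean θ (fun s => Real.exp (-t * Z s)) -
        t * ∑ b ∈ T with ¬ Disjoint (F a) (F b),
          θ ^ #(F a ∪ F b) * bernoulliMean θ (fun s => Real.exp (-t * Z s)) := by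
        rw [hc, ← sum_mul]; ring
    _ ≤ bernoulliMean θ (fun s => if F a ⊆ s then Real.exp (-t * Z s) else 0) -
        t * ∑ b ∈ T with ¬ Disjoint (F a) (F b),
          bernoulliMean θ (fun s => if F a ∪ F b ⊆ s then Real.exp (-t * Z s) else 0) := by
        rw [e1]
        gcongr with b
        exact e2 b
    _ = bernoulliMean θ (fun s => if F a ⊆ s then (1 - t * Y s) * Real.exp (-t * Z s) else 0) := by
        rw [← bernoulliMean_sum, ← bernoulliMean_const_mul, ← bernoulliMean_sub]
        congr 1
        ext s
        by_cases h : F a ⊆ s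
        · simp only [h, if_true, union_subset_iff, true_and, hY, hitCount, sub_mul, one_mul,
            mul_assoc, sum_mul, ite_mul, zero_mul]
        · simp [h, union_subset_iff]
    _ ≤ _ := by
        refine bernoulliMean_mono h0 h1 fun s => ?_
        split_ifs with h
        · rw [hX, mul_add, Real.exp_add, mul_comm]
          refine mul_le_mul_of_nonneg_left ?_ (Real.exp_pos _).le
          have := Real.add_one_le_exp (-t * Y s)
          linarith
        · rfl

/-- **Janson's inequality** (lower tail): `D` bounds the sum of the joint probabilities over the
intersecting pairs, the diagonal included. -/
theorem janson_lower_tail {θ : ℝ} (h0 : 0 ≤ θ) (h1 : θ ≤ 1) (T : Finset κ) (F : κ → Finset ι)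
    {D x : ℝ} (hD : 0 < D)
    (hDelta : ∑ a ∈ T, ∑ b ∈ T with ¬ Disjoint (F a) (F b), θ ^ #(F a ∪ F b) ≤ D)
    (hx : x ≤ ∑ a ∈ T, θ ^ #(F a)) :
    bernoulliMean θ (fun s => if hitCount T F s ≤ x then 1 else 0) ≤
      Real.exp (-((∑ a ∈ T, θ ^ #(F a)) - x) ^ 2 / (2 * D)) := by
  set μ := ∑ a ∈ T, θ ^ #(F a) with hμ
  set X := hitCount T F with hX
  set Ψ : ℝ → ℝ := fun t => bernoulliMean θ (fun s => Real.exp (-t * X s)) with hΨ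
  have hder : ∀ t, HasDerivAt Ψ
      (-bernoulliMean θ (fun s => X s * Real.exp (-t * X s))) t := by
    intro t
    have : HasDerivAt (fun t => ∑ s : Finset ι,
        θ ^ #s * (1 - θ) ^ #sᶜ * Real.exp (-t * X s))
        (∑ s : Finset ι, θ ^ #s * (1 - θ) ^ #sᶜ * (Real.exp (-t * X s) * (-1 * X s))) t := by
      refine HasDerivAt.fun_sum fun s _ => ?_
      exact (((hasDerivAt_id t).neg.mul_const (X s)).exp).const_mul _
    refine this.congr_deriv ?_
    simp only [bernoulliMean]
    rw [← sum_neg_distrib]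
    exact sum_congr rfl fun s _ => by ring
  -- the differential inequality `Ψ' ≤ -(μ - t D) Ψ`, integrated below by monotonicity of `g`
  have hineq : ∀ t, 0 ≤ t → (μ - t * D) * Ψ t ≤
      bernoulliMean θ (fun s => X s * Real.exp (-t * X s)) := by
    intro t ht
    have hp : 0 ≤ Ψ t := bernoulliMean_nonneg h0 h1 fun s => (Real.exp_pos _).le
    have e : bernoulliMean θ (fun s => X s * Real.exp (-t * X s)) =
        ∑ a ∈ T, bernoulliMean θ (fun s => if F a ⊆ s then Real.exp (-t * X s) else 0) := by
      rw [← bernoulliMean_sum]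
      congr 1; ext s
      simp only [hX, hitCount, sum_mul, ite_mul, one_mul, zero_mul]
    rw [e]
    calc (μ - t * D) * Ψ t
        ≤ (μ - t * ∑ a ∈ T, ∑ b ∈ T with ¬ Disjoint (F a) (F b), θ ^ #(F a ∪ F b)) * Ψ t := by
          gcongr
      _ = ∑ a ∈ T, (θ ^ #(F a) -
            t * ∑ b ∈ T with ¬ Disjoint (F a) (F b), θ ^ #(F a ∪ F b)) * Ψ t := by
          rw [← sum_mul, sum_sub_distrib, ← mul_sum]
      _ ≤ _ := sum_le_sum fun a _ => le_bernoulliMean_exp_hitCount h0 h1 ht T F a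
  set g : ℝ → ℝ := fun t => Ψ t * Real.exp (μ * t - D * t ^ 2 / 2) with hg
  have hgd : ∀ t, HasDerivAt g
      (-bernoulliMean θ (fun s => X s * Real.exp (-t * X s)) * Real.exp (μ * t - D * t ^ 2 / 2) +
        Ψ t * (Real.exp (μ * t - D * t ^ 2 / 2) * (μ - D * t))) t := by
    intro t
    refine (hder t).mul (HasDerivAt.exp ?_)
    have h2 := ((hasDerivAt_id t).const_mul μ).sub
      ((((hasDerivAt_id t).pow 2).const_mul D).div_const 2)
    refine h2.congr_deriv ?_
    simp only [id, mul_one, Nat.cast_ofNat]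
    ring
  have hanti : AntitoneOn g (Set.Ici 0) := by
    refine antitoneOn_of_deriv_nonpos (convex_Ici 0)
      (fun t _ => (hgd t).continuousAt.continuousWithinAt)
      (fun t _ => (hgd t).differentiableAt.differentiableWithinAt) fun t ht => ?_
    rw [(hgd t).deriv]
    have ht' : 0 ≤ t := by
      rw [interior_Ici] at ht; exact le_of_lt ht
    have := hineq t ht'
    have he := Real.exp_pos (μ * t - D * t ^ 2 / 2)
    nlinarith
  have hbound : ∀ t, 0 ≤ t → Ψ t ≤ Real.exp (-(μ * t - D * t ^ 2 / 2)) := by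
    intro t ht
    have h := hanti (Set.self_mem_Ici) ht ht
    have hg0 : g 0 = 1 := by
      simp [hg, hΨ, bernoulliMean_one]
    rw [hg0] at h
    rw [Real.exp_neg, ← one_div, le_div_iff₀ (Real.exp_pos _)]
    exact h
  have ht : 0 ≤ (μ - x) / D := div_nonneg (by linarith) hD.le
  -- this `t` minimises the exponent in the exponential Markov inequality
  set t := (μ - x) / D with htdef
  calc bernoulliMean θ (fun s => if X s ≤ x then 1 else 0)
      ≤ bernoulliMean θ (fun s => Real.exp (t * x) * Real.exp (-t * X s)) := by
        refine bernoulliMean_mono h0 h1 fun s => ?_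
        split_ifs with h
        · rw [← Real.exp_add]
          refine Real.one_le_exp ?_
          nlinarith
        · positivity
    _ = Real.exp (t * x) * Ψ t := bernoulliMean_const_mul _ _ _
    _ ≤ Real.exp (t * x) * Real.exp (-(μ * t - D * t ^ 2 / 2)) := by
        gcongr; exact hbound t ht
    _ = _ := by
        rw [← Real.exp_add]
        congr 1
        rw [htdef]
        field_simp
        ring

end Janson

/-! ### Probabilities of elementary events in the binomial random graph -/

section Transfer

variable {V : Type*}

instance [Countable V] : MeasurableSingletonClass (SimpleGraph V) where
  measurableSet_singleton G := by
    have : ({G} : Set (SimpleGraph V)) = SimpleGraph.edgeSet ⁻¹' {G.edgeSet} := by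
      ext G'
      simp
    rw [this]
    exact SimpleGraph.measurable_edgeSet (measurableSet_singleton _)

/-- The pairs of distinct vertices. -/
abbrev VertexPair (V : Type*) : Type _ := {e : Sym2 V // ¬ e.IsDiag}

/-- The graph with a given set of edges. -/
def graphOf (s : Finset (VertexPair V)) : SimpleGraph V :=
  SimpleGraph.fromEdgeSet {e | ∃ h : ¬ e.IsDiag, (⟨e, h⟩ : VertexPair V) ∈ s}

theorem graphOf_adj {s : Finset (VertexPair V)} {u v : V} :
    (graphOf s).Adj u v ↔ ∃ h : u ≠ v, (⟨s(u, v), by simpa using h⟩ : VertexPair V) ∈ s := by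
  simp only [graphOf, SimpleGraph.fromEdgeSet_adj, Set.mem_ofPred_eq]
  constructor
  · rintro ⟨⟨_, h⟩, hne⟩; exact ⟨hne, h⟩
  · rintro ⟨hne, h⟩; exact ⟨⟨_, h⟩, hne⟩

theorem edgeSet_graphOf (s : Finset (VertexPair V)) :
    (graphOf s).edgeSet = Subtype.val '' (s : Set (VertexPair V)) := by
  ext e
  induction e with
  | h u v =>
    rw [SimpleGraph.mem_edgeSet, graphOf_adj]
    constructor
    · rintro ⟨h, hs⟩; exact ⟨_, hs, rfl⟩
    · rintro ⟨⟨e, he⟩, hs, rfl⟩; exact ⟨by simpa using he, hs⟩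

theorem graphOf_injective : Function.Injective (graphOf (V := V)) := by
  intro s t h
  have := congrArg SimpleGraph.edgeSet h
  rw [edgeSet_graphOf, edgeSet_graphOf] at this
  exact_mod_cast Subtype.val_injective.image_injective this

theorem graphOf_surjective [Finite V] : Function.Surjective (graphOf (V := V)) := by
  classical
  cases nonempty_fintype V
  intro G
  refine ⟨univ.filter fun e => e.1 ∈ G.edgeSet, ?_⟩
  ext u v
  rw [graphOf_adj]
  simp only [mem_filter, mem_univ, true_and, SimpleGraph.mem_edgeSet]
  exact ⟨fun ⟨_, h⟩ => h, fun h => ⟨h.ne, h⟩⟩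

variable [Fintype V] [DecidableEq V]

open Classical in
/-- Probabilities in `G(V, p)` as Bernoulli means over the set of edges. -/
theorem binomialRandom_real_eq (p : unitInterval) (Q : SimpleGraph V → Prop) :
    (SimpleGraph.binomialRandom V p).real {G | Q G} =
      bernoulliMean (p : ℝ) (fun s => if Q (graphOf s) then 1 else 0) := by
  have hfin : {G | Q G} = ((univ.filter fun s => Q (graphOf s)).image (graphOf (V := V)) :
      Finset (SimpleGraph V)) := by
    ext G
    obtain ⟨s, rfl⟩ := graphOf_surjective G
    simp only [Set.mem_ofPred_eq, coe_image, coe_filter, mem_univ, true_and, Set.mem_image]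
    exact ⟨fun h => ⟨s, h, rfl⟩, fun ⟨t, ht, h⟩ => h ▸ ht⟩
  rw [hfin, ← sum_measureReal_singleton, sum_image fun a _ b _ h => graphOf_injective h,
    sum_filter, bernoulliMean]
  refine sum_congr rfl fun s _ => ?_
  split_ifs with h
  · have h1 : (graphOf s).edgeSet.ncard = #s := by
      rw [edgeSet_graphOf, Set.ncard_image_of_injective _ Subtype.val_injective,
        Set.ncard_coe_finset]
    have h2 : #sᶜ = (Nat.card V).choose 2 - #s := by
      rw [card_compl, Nat.card_eq_fintype_card, ← Sym2.card_subtype_not_diag]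
    rw [measureReal_def, SimpleGraph.binomialRandom_singleton, h1, h2]
    simp
  · simp

/-- The complement of a random set is a random set with complementary probabilities. -/
theorem bernoulliMean_compl {ι : Type*} [Fintype ι] [DecidableEq ι] (θ : ℝ) (f : Finset ι → ℝ) :
    bernoulliMean θ f = bernoulliMean (1 - θ) (fun s => f sᶜ) := by
  unfold bernoulliMean
  refine sum_bij' (fun s _ => sᶜ) (fun s _ => sᶜ) (by simp) (by simp) (by simp) (by simp) ?_
  intro s _
  simp only [compl_compl, sub_sub_cancel]
  ring

open Classical in
/-- Probabilities in `G(V, p)` as Bernoulli means over the set of non-edges. -/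
theorem binomialRandom_real_eq_compl (p : unitInterval) (Q : SimpleGraph V → Prop) :
    (SimpleGraph.binomialRandom V p).real {G | Q G} =
      bernoulliMean (1 - p : ℝ) (fun s => if Q (graphOf sᶜ) then 1 else 0) := by
  rw [binomialRandom_real_eq, bernoulliMean_compl]

/-- The pairs between `A` and `B`. -/
def crossPairs (A B : Finset V) : Finset (VertexPair V) :=
  univ.filter fun e => ∃ a ∈ A, ∃ b ∈ B, e.1 = s(a, b)

/-- The pairs inside `S`. -/
def innerPairs (S : Finset V) : Finset (VertexPair V) :=
  univ.filter fun e => ∀ v ∈ e.1, v ∈ S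

theorem card_crossPairs {A B : Finset V} (h : Disjoint A B) :
    #(crossPairs A B) = #A * #B := by
  rw [← card_product, eq_comm]
  have hne : ∀ x : V × V, x ∈ A ×ˢ B → ¬ (s(x.1, x.2)).IsDiag := fun x hx => by
    rw [mem_product] at hx
    simpa using fun e : x.1 = x.2 => (disjoint_left.1 h hx.1) (e ▸ hx.2)
  refine card_bij (fun x hx => ⟨s(x.1, x.2), hne x hx⟩) ?_ ?_ ?_
  · intro x hx
    rw [mem_product] at hx
    simp only [crossPairs, mem_filter, mem_univ, true_and]
    exact ⟨_, hx.1, _, hx.2, rfl⟩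
  · rintro ⟨a, b⟩ hx ⟨a', b'⟩ hx' he
    rw [mem_product] at hx hx'
    simp only [Subtype.mk.injEq, Sym2.eq_iff] at he
    rcases he with ⟨rfl, rfl⟩ | ⟨rfl, rfl⟩
    · rfl
    · exact absurd hx'.2 (disjoint_left.1 h hx.1)
  · rintro ⟨e, he⟩ hx
    simp only [crossPairs, mem_filter, mem_univ, true_and] at hx
    obtain ⟨a, ha, b, hb, rfl⟩ := hx
    exact ⟨(a, b), mem_product.2 ⟨ha, hb⟩, rfl⟩

theorem card_innerPairs (S : Finset V) : #(innerPairs S) = (#S).choose 2 := by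
  rw [← Sym2.card_image_offDiag, ← card_map (Function.Embedding.subtype _)]
  congr 1
  ext e
  induction e with
  | h u v =>
    simp only [innerPairs, Finset.mem_map, mem_filter, mem_univ, true_and, Function.Embedding.coe_subtype,
      Subtype.exists, mem_image, mem_offDiag, Prod.exists]
    constructor
    · rintro ⟨a, ha, h, rfl⟩
      exact ⟨u, v, ⟨h _ (by simp), h _ (by simp), by simpa using ha⟩, rfl⟩
    · rintro ⟨a, b, ⟨ha, hb, hab⟩, he⟩
      refine ⟨s(u, v), ?_, ?_, rfl⟩
      · rw [← he]; simpa using hab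
      · rw [← he]
        simp [ha, hb]

theorem innerPairs_inter (S S' : Finset V) :
    innerPairs S ∩ innerPairs S' = innerPairs (S ∩ S') := by
  ext e
  simp only [innerPairs, mem_inter, mem_filter, mem_univ, true_and]
  exact ⟨fun h v hv => ⟨h.1 v hv, h.2 v hv⟩, fun h => ⟨fun v hv => (h v hv).1, fun v hv => (h v hv).2⟩⟩

theorem crossPairs_subset_iff {A B : Finset V} (h : Disjoint A B) {s : Finset (VertexPair V)} :
    crossPairs A B ⊆ s ↔ ∀ a ∈ A, ∀ b ∈ B, (graphOf s).Adj a b := by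
  constructor
  · intro hs a ha b hb
    have hne : a ≠ b := fun e => disjoint_left.1 h ha (e ▸ hb)
    refine graphOf_adj.2 ⟨hne, hs ?_⟩
    simp only [crossPairs, mem_filter, mem_univ, true_and]
    exact ⟨a, ha, b, hb, rfl⟩
  · rintro hs ⟨e, he⟩ hx
    simp only [crossPairs, mem_filter, mem_univ, true_and] at hx
    obtain ⟨a, ha, b, hb, rfl⟩ := hx
    exact (graphOf_adj.1 (hs a ha b hb)).2

theorem graphOf_compl_adj {s : Finset (VertexPair V)} {u v : V} (h : u ≠ v) :
    (graphOf sᶜ).Adj u v ↔ ¬ (graphOf s).Adj u v := by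
  simp [graphOf_adj, h]

theorem innerPairs_subset_iff {S : Finset V} {s : Finset (VertexPair V)} :
    innerPairs S ⊆ s ↔ ∀ a ∈ S, ∀ b ∈ S, ¬ (graphOf sᶜ).Adj a b := by
  constructor
  · intro hs a ha b hb hab
    refine (graphOf_compl_adj hab.ne).1 hab (graphOf_adj.2 ⟨?_, hs ?_⟩)
    · exact hab.ne
    · simp only [innerPairs, mem_filter, mem_univ, true_and]
      simp [ha, hb]
  · rintro hs ⟨e, he⟩ hx
    induction e with
    | h u v =>
      have hne : u ≠ v := by simpa using he
      simp only [innerPairs, mem_filter, mem_univ, true_and] at hx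
      have := hs u (hx _ (by simp)) v (hx _ (by simp))
      rw [graphOf_compl_adj hne, not_not] at this
      exact (graphOf_adj.1 this).2

/-- The probability that there is no edge between `A` and `B`. -/
theorem prob_no_edge_between (p : unitInterval) {A B : Finset V} (h : Disjoint A B) :
    (SimpleGraph.binomialRandom V p).real {G | ∀ a ∈ A, ∀ b ∈ B, ¬ G.Adj a b} =
      (1 - p : ℝ) ^ (#A * #B) := by
  classical
  rw [binomialRandom_real_eq_compl, ← card_crossPairs h, ← bernoulliMean_subset]
  congr 1; ext s
  have : (∀ a ∈ A, ∀ b ∈ B, ¬ (graphOf sᶜ).Adj a b) ↔ crossPairs A B ⊆ s := by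
    rw [crossPairs_subset_iff h]
    refine forall₂_congr fun a ha => forall₂_congr fun b hb => ?_
    rw [graphOf_compl_adj fun e : a = b => disjoint_left.1 h ha (e ▸ hb), not_not]
  simp only [this]

/-- The probability that `S` is an independent set. -/
theorem prob_independent (p : unitInterval) (S : Finset V) :
    (SimpleGraph.binomialRandom V p).real {G | ∀ a ∈ S, ∀ b ∈ S, ¬ G.Adj a b} =
      (1 - p : ℝ) ^ (#S).choose 2 := by
  classical
  rw [binomialRandom_real_eq_compl, ← card_innerPairs, ← bernoulliMean_subset]
  congr 1; ext s
  by_cases h : innerPairs S ⊆ s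
  · rw [if_pos h, if_pos (innerPairs_subset_iff.1 h)]
  · rw [if_neg h, if_neg (mt innerPairs_subset_iff.2 h)]

open Classical in
/-- Few common neighbours of `T` in `W` are exponentially unlikely. The stars from the vertices of
`W` to `T` have disjoint edge sets, so only the diagonal enters in Janson's inequality. -/
theorem prob_few_common_neighbors (p : unitInterval) (hp : 0 < (p : ℝ)) {T W : Finset V}
    (h : Disjoint T W) (hW : W.Nonempty) :
    (SimpleGraph.binomialRandom V p).real
      {G | (#(W.filter fun w => ∀ t ∈ T, G.Adj t w) : ℝ) ≤ #W * (p : ℝ) ^ #T / 2} ≤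
      Real.exp (-(#W * (p : ℝ) ^ #T / 8)) := by
  set r := (p : ℝ) ^ #T with hr
  have hrpos : 0 < r := pow_pos hp _
  have hWpos : (0 : ℝ) < #W := by exact_mod_cast hW.card_pos
  have hd : ∀ w ∈ W, Disjoint T {w} := fun w hw =>
    disjoint_singleton_right.2 fun hT => disjoint_left.1 h hT hw
  have hc : ∀ w ∈ W, #(crossPairs T {w}) = #T := fun w hw => by
    rw [card_crossPairs (hd w hw)]; simp
  have hμ : ∑ w ∈ W, (p : ℝ) ^ #(crossPairs T {w}) = #W * r := by
    rw [sum_congr rfl fun w hw => by rw [hc w hw], sum_const, nsmul_eq_mul]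
  have hD : ∑ w ∈ W, ∑ w' ∈ W with ¬ Disjoint (crossPairs T {w}) (crossPairs T {w'}),
      (p : ℝ) ^ #(crossPairs T {w} ∪ crossPairs T {w'}) ≤ #W * r := by
    rw [← nsmul_eq_mul]
    refine sum_le_card_nsmul _ _ _ fun w hw => ?_
    calc _ ≤ ∑ w' ∈ {w}, (p : ℝ) ^ #(crossPairs T {w} ∪ crossPairs T {w'}) := by
          refine sum_le_sum_of_subset_of_nonneg ?_ fun _ _ _ => by positivity
          intro w' hw'
          obtain ⟨hw'W, hnd⟩ := mem_filter.1 hw'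
          rw [not_disjoint_iff] at hnd
          obtain ⟨e, he, he'⟩ := hnd
          simp only [crossPairs, mem_filter, mem_univ, true_and, mem_singleton,
            exists_eq_left] at he he'
          obtain ⟨a, ha, h1⟩ := he
          obtain ⟨b, hb, h2⟩ := he'
          rw [h1, Sym2.eq_iff] at h2
          rcases h2 with ⟨_, h2⟩ | ⟨h2, _⟩
          · exact mem_singleton.2 h2.symm
          · exact absurd hw'W (disjoint_left.1 h (h2 ▸ ha))
      _ = r := by simp [hc w hw, hr]
  have key := janson_lower_tail (x := #W * r / 2) hp.le p.2.2 W (fun w => crossPairs T {w})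
    (D := #W * r) (by positivity) hD (by rw [hμ]; nlinarith [mul_pos hWpos hrpos])
  rw [hμ] at key
  rw [binomialRandom_real_eq]
  refine le_trans (le_of_eq ?_) (key.trans (Real.exp_le_exp.2 (le_of_eq ?_)))
  · congr 1; ext s
    have : (#(W.filter fun w => ∀ t ∈ T, (graphOf s).Adj t w) : ℝ) =
        hitCount W (fun w => crossPairs T {w}) s := by
      rw [hitCount, card_eq_sum_ones, Nat.cast_sum, sum_filter]
      refine sum_congr rfl fun w hw => ?_
      simp [crossPairs_subset_iff (hd w hw)]
    simp only [this]
  · field_simp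
    ring

/-- The proportion of the `k`-subsets of an `M`-set that contain a given `i`-set is at most
`(k / M) ^ i`. -/
theorem choose_sub_mul_pow_le {k M : ℕ} (hk : k ≤ M) :
    ∀ i ≤ k, (M - i).choose (k - i) * M ^ i ≤ k ^ i * M.choose k := by
  intro i
  induction i with
  | zero => simp
  | succ i ih =>
    intro hi
    have ih := ih (by omega)
    obtain ⟨a, ha⟩ : ∃ a, k - i = a + 1 := ⟨k - i - 1, by omega⟩
    obtain ⟨b, hb⟩ : ∃ b, M - i = b + 1 := ⟨M - i - 1, by omega⟩
    have e1 : k - (i + 1) = a := by omega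
    have e2 : M - (i + 1) = b := by omega
    rw [ha, hb] at ih
    rw [e1, e2]
    have h1 := Nat.add_one_mul_choose_eq b a
    have h2 : (a + 1) * M ≤ k * (b + 1) := by
      have hki : k = a + 1 + i := by omega
      have hMi : M = b + 1 + i := by omega
      have hab : a ≤ b := by omega
      rw [hki, hMi]; nlinarith
    have h3 : b.choose a * M ≤ k * (b + 1).choose (a + 1) := by
      have : (b + 1) * (b.choose a * M) ≤ (b + 1) * (k * (b + 1).choose (a + 1)) := by
        calc (b + 1) * (b.choose a * M) = (b + 1) * b.choose a * M := by ring
          _ = (b + 1).choose (a + 1) * ((a + 1) * M) := by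
            rw [h1]; ring
          _ ≤ (b + 1).choose (a + 1) * (k * (b + 1)) := Nat.mul_le_mul_left _ h2
          _ = _ := by ring
      exact Nat.le_of_mul_le_mul_left this (Nat.succ_pos b)
    calc b.choose a * M ^ (i + 1) = b.choose a * M * M ^ i := by ring
      _ ≤ k * (b + 1).choose (a + 1) * M ^ i := Nat.mul_le_mul_right _ h3
      _ = k * ((b + 1).choose (a + 1) * M ^ i) := by ring
      _ ≤ k * (k ^ i * M.choose k) := Nat.mul_le_mul_left _ ih
      _ = _ := by ring

theorem card_powersetCard_filter_superset {V : Type*} [DecidableEq V]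
    {W I : Finset V} (hI : I ⊆ W) {k : ℕ} :
    #((W.powersetCard k).filter fun S => I ⊆ S) ≤ (#W - #I).choose (k - #I) := by
  rw [← card_sdiff_of_subset hI, ← card_powersetCard]
  refine card_le_card_of_injOn (fun S => S \ I) ?_ ?_
  · intro S hS
    rw [mem_coe, mem_filter, mem_powersetCard] at hS
    rw [mem_coe, mem_powersetCard, card_sdiff_of_subset hS.2, hS.1.2]
    exact ⟨sdiff_subset_sdiff hS.1.1 le_rfl, rfl⟩
  · intro S hS S' hS' he
    rw [mem_coe, mem_filter] at hS hS'
    simp only at he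
    rw [← sdiff_union_of_subset hS.2, he, sdiff_union_of_subset hS'.2]

/-- The correlation sum over the `k`-subsets of `W` that meet a given one in at least two
vertices, sorted by the intersection. -/
theorem sum_correlation_le {q : ℝ} (hq : 0 < q) {W : Finset V} {k : ℕ} (hk : k ≤ #W)
    {S : Finset V} (hS : S ∈ W.powersetCard k) :
    ∑ S' ∈ W.powersetCard k with ¬ Disjoint (innerPairs S) (innerPairs S'),
      q ^ #(innerPairs S ∪ innerPairs S') ≤
    (#W).choose k * (q ^ k.choose 2) ^ 2 *
      ∑ i ∈ Icc 2 k, ((k : ℝ) ^ 2 / #W) ^ i * (q ^ i.choose 2)⁻¹ := by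
  obtain ⟨hSW, hSk⟩ := mem_powersetCard.1 hS
  have hunion : ∀ S' ∈ W.powersetCard k, q ^ #(innerPairs S ∪ innerPairs S') =
      (q ^ k.choose 2) ^ 2 * (q ^ (#(S ∩ S')).choose 2)⁻¹ := fun S' hS' => by
    have h1 := card_union_add_card_inter (innerPairs S) (innerPairs S')
    rw [innerPairs_inter, card_innerPairs, card_innerPairs, card_innerPairs, hSk,
      (mem_powersetCard.1 hS').2] at h1
    rw [eq_mul_inv_iff_mul_eq₀ (by positivity), ← pow_add, h1]
    ring
  calc _ = ∑ S' ∈ W.powersetCard k with ¬ Disjoint (innerPairs S) (innerPairs S'),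
        (q ^ k.choose 2) ^ 2 * (q ^ (#(S ∩ S')).choose 2)⁻¹ :=
        sum_congr rfl fun S' hS' => hunion S' (mem_filter.1 hS').1
    _ ≤ ∑ S' ∈ W.powersetCard k with ¬ Disjoint (innerPairs S) (innerPairs S'),
        ∑ I ∈ S.powerset with 2 ≤ #I,
          if I ⊆ S' then (q ^ k.choose 2) ^ 2 * (q ^ (#I).choose 2)⁻¹ else 0 := by
        refine sum_le_sum fun S' hS' => ?_
        have hmem : S ∩ S' ∈ S.powerset.filter fun I => 2 ≤ #I := by
          refine mem_filter.2 ⟨mem_powerset.2 inter_subset_left, ?_⟩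
          by_contra hlt
          have : #(innerPairs S ∩ innerPairs S') = 0 := by
            rw [innerPairs_inter, card_innerPairs, Nat.choose_eq_zero_of_lt (by omega)]
          exact (mem_filter.1 hS').2 (disjoint_iff_inter_eq_empty.2 (card_eq_zero.1 this))
        refine le_trans (le_of_eq ?_) (single_le_sum (fun I _ => ?_) hmem)
        · rw [if_pos inter_subset_right]
        · split_ifs <;> positivity
    _ ≤ ∑ S' ∈ W.powersetCard k, ∑ I ∈ S.powerset with 2 ≤ #I,
          if I ⊆ S' then (q ^ k.choose 2) ^ 2 * (q ^ (#I).choose 2)⁻¹ else 0 := by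
        refine sum_le_sum_of_subset_of_nonneg (filter_subset _ _) fun S' _ _ =>
          sum_nonneg fun I _ => ?_
        split_ifs <;> positivity
    _ = ∑ I ∈ S.powerset with 2 ≤ #I, #((W.powersetCard k).filter fun S' => I ⊆ S') *
          ((q ^ k.choose 2) ^ 2 * (q ^ (#I).choose 2)⁻¹) := by
        rw [sum_comm]
        refine sum_congr rfl fun I _ => ?_
        rw [← sum_filter, sum_const, nsmul_eq_mul]
    _ ≤ ∑ I ∈ S.powerset with 2 ≤ #I, (#W).choose k * ((k : ℝ) / #W) ^ #I *
          ((q ^ k.choose 2) ^ 2 * (q ^ (#I).choose 2)⁻¹) := by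
        refine sum_le_sum fun I hI => ?_
        rw [mem_filter, mem_powerset] at hI
        have hIk : #I ≤ k := hSk ▸ card_le_card hI.1
        have hW0 : (0 : ℝ) < #W := by
          have : 0 < #W := by omega
          exact_mod_cast this
        refine mul_le_mul_of_nonneg_right ?_ (by positivity)
        have h1 : (#((W.powersetCard k).filter fun S' => I ⊆ S') : ℝ) ≤
            ((#W - #I).choose (k - #I) : ℕ) := by
          exact_mod_cast card_powersetCard_filter_superset (hI.1.trans hSW)
        have h2 : (((#W - #I).choose (k - #I) : ℕ) : ℝ) * (#W : ℝ) ^ #I ≤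
            (k : ℝ) ^ #I * (#W).choose k := by
          exact_mod_cast choose_sub_mul_pow_le hk _ hIk
        refine h1.trans ?_
        rw [div_pow, mul_div_assoc', le_div_iff₀ (by positivity)]
        linarith
    _ = (#W).choose k * (q ^ k.choose 2) ^ 2 *
          ∑ I ∈ S.powerset with 2 ≤ #I, ((k : ℝ) / #W) ^ #I * (q ^ (#I).choose 2)⁻¹ := by
        rw [mul_sum]
        exact sum_congr rfl fun I _ => by ring
    _ ≤ _ := by
        refine mul_le_mul_of_nonneg_left ?_ (by positivity)
        rw [sum_filter, sum_powerset_apply_card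
          (fun i => if 2 ≤ i then ((k : ℝ) / #W) ^ i * (q ^ i.choose 2)⁻¹ else 0), hSk]
        calc _ ≤ ∑ i ∈ range (k + 1),
              if 2 ≤ i then ((k : ℝ) ^ 2 / #W) ^ i * (q ^ i.choose 2)⁻¹ else 0 := by
              refine sum_le_sum fun i _ => ?_
              split_ifs
              · rw [nsmul_eq_mul, ← mul_assoc]
                refine mul_le_mul_of_nonneg_right ?_ (by positivity)
                have : ((k.choose i : ℕ) : ℝ) ≤ (k : ℝ) ^ i := by
                  exact_mod_cast Nat.choose_le_pow k i
                calc (k.choose i : ℝ) * ((k : ℝ) / #W) ^ i ≤ (k : ℝ) ^ i * ((k : ℝ) / #W) ^ i := by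
                      gcongr
                  _ = _ := by rw [← mul_pow]; congr 1; ring
              · simp
          _ = _ := by
              rw [← sum_filter]
              congr 1
              ext i; simp; omega

/-- A large set contains an independent `k`-set with very high probability: `y` bounds the
normalised second moment of the number of such sets. -/
theorem prob_no_independent_subset (p : unitInterval) (hp : (p : ℝ) < 1) {W : Finset V} {k : ℕ}
    (hk : k ≤ #W) {y : ℝ} (hy : 0 < y)
    (hsum : ∑ i ∈ Icc 2 k, ((k : ℝ) ^ 2 / #W) ^ i * ((1 - p : ℝ) ^ i.choose 2)⁻¹ ≤ y) :
    (SimpleGraph.binomialRandom V p).real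
      {G | ∀ S ⊆ W, #S = k → ∃ a ∈ S, ∃ b ∈ S, G.Adj a b} ≤ Real.exp (-(1 / (2 * y))) := by
  classical
  set q : ℝ := 1 - p with hq
  have hq0 : 0 < q := by linarith
  have hq1 : q ≤ 1 := by have := p.2.1; linarith
  set T := W.powersetCard k
  have hμ : ∑ S ∈ T, q ^ #(innerPairs S) = (#W).choose k * q ^ k.choose 2 := by
    rw [← card_powersetCard, ← nsmul_eq_mul, ← sum_const]
    exact sum_congr rfl fun S hS => by rw [card_innerPairs, (mem_powersetCard.1 hS).2]
  set μ := ((#W).choose k : ℝ) * q ^ k.choose 2 with hμdef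
  have hμpos : 0 < μ := by
    have : 0 < (#W).choose k := Nat.choose_pos hk
    positivity
  have hD : ∑ S ∈ T, ∑ S' ∈ T with ¬ Disjoint (innerPairs S) (innerPairs S'),
      q ^ #(innerPairs S ∪ innerPairs S') ≤ μ ^ 2 * y := by
    calc _ ≤ #T • ((#W).choose k * (q ^ k.choose 2) ^ 2 * y) := by
          refine sum_le_card_nsmul _ _ _ fun S hS => ?_
          exact (sum_correlation_le hq0 hk hS).trans (by gcongr)
      _ = _ := by rw [card_powersetCard, nsmul_eq_mul, hμdef]; ring
  have key := janson_lower_tail (x := 0) hq0.le hq1 T innerPairs (D := μ ^ 2 * y)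
    (by positivity) hD (by rw [hμ]; exact hμpos.le)
  rw [hμ] at key
  rw [binomialRandom_real_eq_compl]
  refine le_trans (bernoulliMean_mono hq0.le hq1 fun s => ?_)
    (key.trans (Real.exp_le_exp.2 (le_of_eq ?_)))
  · split_ifs with h1 h2 h2
    · rfl
    · refine absurd (le_of_eq (sum_eq_zero fun S hS => ?_)) h2
      rw [if_neg]
      rw [innerPairs_subset_iff]
      push Not
      exact h1 S (mem_powersetCard.1 hS).1 (mem_powersetCard.1 hS).2
    · norm_num
    · rfl
  · field_simp
    ring

end Transfer

/-! ### Paths in saturated graphs -/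

section Paths

variable {V : Type*} {G H : SimpleGraph V} {m : ℕ}

/-- A cycle whose first edge is the added edge `uv` leaves a path from `u` to `v` in `H`. -/
theorem exists_isPath_of_isCycle_snd {u v : V} (c : (H ⊔ SimpleGraph.edge u v).Walk u u)
    (hc : c.IsCycle) (hv : c.snd = v) :
    ∃ p : H.Walk u v, p.IsPath ∧ p.length + 1 = c.length := by
  cases c with
  | nil => exact absurd hc (by simp)
  | cons h q =>
    rw [SimpleGraph.Walk.snd_cons] at hv
    subst hv
    rw [SimpleGraph.Walk.cons_isCycle_iff] at hc
    have hq : ∀ e ∈ q.edges, e ∈ H.edgeSet := by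
      intro e he
      have h1 := q.edges_subset_edgeSet he
      rw [SimpleGraph.edgeSet_sup] at h1
      rcases h1 with h1 | h1
      · exact h1
      · rw [SimpleGraph.edgeSet_edge_of_ne h.ne] at h1
        rw [Set.mem_singleton_iff] at h1
        exact absurd (h1 ▸ he) hc.2
    exact ⟨(q.transfer H hq).reverse, (hc.1.transfer hq).reverse, by simp⟩

/-- In a `C_m`-saturated graph every missing edge is bridged by a path with `m - 1` edges. -/
theorem IsSaturatedIn.exists_isPath (hm : 3 ≤ m)
    (hsat : IsSaturatedIn (SimpleGraph.cycleGraph m) G H) {u v : V} (huv : G.Adj u v)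
    (hn : ¬ H.Adj u v) : ∃ p : H.Walk u v, p.IsPath ∧ p.length + 1 = m := by
  classical
  set K := H ⊔ SimpleGraph.edge u v with hK
  have hKG : K ≤ G := sup_le hsat.prop.1 <| by
    intro a b hab
    rw [SimpleGraph.edge_adj] at hab
    rcases hab.1 with ⟨rfl, rfl⟩ | ⟨rfl, rfl⟩
    · exact huv
    · exact huv.symm
  have hcon : (SimpleGraph.cycleGraph m).IsContained K := by
    by_contra hfree
    have := hsat.le_of_ge ⟨hKG, hfree⟩ le_sup_left
    exact hn (this (Or.inr ((SimpleGraph.edge_adj ..).2 ⟨Or.inl ⟨rfl, rfl⟩, huv.ne⟩)))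
  obtain ⟨w, c, hc, hlen⟩ := (SimpleGraph.cycleGraph_isContained_iff (by omega)).1 hcon
  by_cases he : s(u, v) ∈ c.edges
  · have hu := c.fst_mem_support_of_mem_edges he
    have hc' := hc.rotate hu
    have hlen' : (c.rotate u hu).length = m := by simpa using hlen
    have he' : s(u, v) ∈ (c.rotate u hu).edges := (c.rotate_edges u hu).perm.mem_iff.2 he
    generalize c.rotate u hu = c' at hc' hlen' he'
    by_cases hs : c'.snd = v
    · obtain ⟨p, hp, hl⟩ := exists_isPath_of_isCycle_snd c' hc' hs
      exact ⟨p, hp, by omega⟩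
    · have hs' : c'.reverse.snd = v := by
        cases c' with
        | nil => exact absurd hc' (by simp)
        | cons h q =>
          rw [SimpleGraph.Walk.snd_cons] at hs
          rw [SimpleGraph.Walk.edges_cons, List.mem_cons] at he'
          have hmem : s(u, v) ∈ q.edges := he'.resolve_left fun e => by
            rcases Sym2.eq_iff.1 e with ⟨_, e⟩ | ⟨e, e'⟩
            · exact hs e.symm
            · exact hs (e ▸ e'.symm)
          have hq := ((SimpleGraph.Walk.cons_isCycle_iff _ _).1 hc').1
          rw [SimpleGraph.Walk.snd_reverse, SimpleGraph.Walk.penultimate_cons_of_not_nil,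
            ← hq.eq_penultimate_of_mem_edges hmem]
          intro hnil
          rw [SimpleGraph.Walk.edges_eq_nil.2 hnil] at hmem
          simp at hmem
      obtain ⟨p, hp, hl⟩ := exists_isPath_of_isCycle_snd c'.reverse hc'.reverse hs'
      exact ⟨p, hp, by simpa [hlen'] using hl⟩
  · refine absurd ?_ hsat.prop.2
    have hcH : ∀ e ∈ c.edges, e ∈ H.edgeSet := by
      intro e hec
      have h1 := c.edges_subset_edgeSet hec
      rw [SimpleGraph.edgeSet_sup, SimpleGraph.edgeSet_edge_of_ne huv.ne] at h1
      rcases h1 with h1 | h1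
      · exact h1
      · rw [Set.mem_singleton_iff] at h1
        exact absurd (h1 ▸ hec) he
    rw [SimpleGraph.cycleGraph_isContained_iff (by omega)]
    exact ⟨w, c.transfer H hcH, hc.transfer hcH, by simpa using hlen⟩

/-- A path with `m - 1` edges closes to a copy of `C_m`. -/
theorem cycleGraph_isContained_of_isPath (hm : 3 ≤ m) {K : SimpleGraph V} (hHK : H ≤ K) {u v : V}
    (huv : K.Adj u v) (hn : ¬ H.Adj u v) {p : H.Walk u v} (hp : p.IsPath)
    (hl : p.length + 1 = m) : (SimpleGraph.cycleGraph m).IsContained K := by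
  rw [SimpleGraph.cycleGraph_isContained_iff (by omega)]
  refine ⟨v, SimpleGraph.Walk.cons huv.symm (p.mapLe hHK), ?_, by simpa using hl⟩
  rw [SimpleGraph.Walk.cons_isCycle_iff]
  refine ⟨by simpa using hp, fun he => hn ?_⟩
  rw [SimpleGraph.Walk.edges_mapLe_eq_edges] at he
  exact (p.adj_of_mem_edges he).symm

end Paths

/-! ### Paths inside hanging trees -/

section HangingTrees

variable {V : Type*} {H : SimpleGraph V} {par : V → V} {K : Set V}

theorem iterate_mem_of_closed (hK : ∀ v ∈ K, par v ∈ K) {v : V} {i j : ℕ} (hij : i ≤ j)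
    (h : par^[i] v ∈ K) : par^[j] v ∈ K := by
  obtain ⟨k, rfl⟩ := Nat.exists_eq_add_of_le' hij
  rw [Function.iterate_add_apply]
  generalize par^[i] v = w at h
  induction k with
  | zero => exact h
  | succ k ih => rw [Function.iterate_succ_apply']; exact hK _ (ih (by omega))

/-- A path that starts by leaving `par w` towards its child `w` keeps descending. -/
theorem iterate_length_of_descending (hK : ∀ v ∈ K, par v ∈ K)
    (hnbr : ∀ v ∉ K, ∀ w, H.Adj v w → par v = w ∨ par w = v) {w v : V} (q : H.Walk w v)
    (hq : q.IsPath) (hw : w ∉ K) (hpar : par w ∉ q.support) : par^[q.length] v = w := by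
  induction q with
  | nil => rfl
  | @cons w x v h q ih =>
    rw [SimpleGraph.Walk.cons_isPath_iff] at hq
    rcases hnbr w hw x h with h1 | h1
    · exact absurd (by simp [h1]) hpar
    · have hx : x ∉ K := fun hx => hw (h1 ▸ hK x hx)
      rw [SimpleGraph.Walk.length_cons, Function.iterate_succ_apply', ih hq.1 hx (h1 ▸ hq.2), h1]

/-- `u` hangs at depth `a` below `r`: `r` is its `a`-th ancestor and the only one of them
in `K`. -/
def HangsBelow (par : V → V) (K : Set V) (r : V) (a : ℕ) (u : V) : Prop :=
  par^[a] u = r ∧ ∀ i < a, par^[i] u ∉ K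

theorem HangsBelow.notMem {r u : V} {a : ℕ} (h : HangsBelow par K r (a + 1) u) : u ∉ K :=
  h.2 0 (by omega)

theorem HangsBelow.parent {r u : V} {a : ℕ} (h : HangsBelow par K r (a + 1) u) :
    HangsBelow par K r a (par u) :=
  ⟨by rw [← Function.iterate_succ_apply]; exact h.1,
    fun i hi => by rw [← Function.iterate_succ_apply]; exact h.2 _ (by omega)⟩

/-- A path from a vertex of a hanging tree to the root only climbs. -/
theorem HangsBelow.length_le_of_root (hK : ∀ v ∈ K, par v ∈ K)
    (hnbr : ∀ v ∉ K, ∀ w, H.Adj v w → par v = w ∨ par w = v) {r u : V} (hr : r ∈ K)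
    (p : H.Walk u r) (hp : p.IsPath) {a : ℕ} (hu : HangsBelow par K r a u) : p.length ≤ a := by
  induction p generalizing a with
  | nil => simp
  | @cons u w r h q ih =>
    rw [SimpleGraph.Walk.cons_isPath_iff] at hp
    cases a with
    | zero =>
      have : u = r := hu.1
      exact absurd (this ▸ q.end_mem_support) hp.2
    | succ a =>
      rcases hnbr u hu.notMem w h with h1 | h1
      · have := ih hr hp.1 (h1 ▸ hu.parent)
        simpa using this
      · have hw : w ∉ K := fun hw => hu.notMem (h1 ▸ hK w hw)
        have h2 := iterate_length_of_descending hK hnbr q hp.1 hw (h1 ▸ hp.2)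
        exact absurd (h2 ▸ iterate_mem_of_closed hK (Nat.zero_le _) hr) hw

/-- Inside a hanging tree a path is no longer than the detour through the root. -/
theorem HangsBelow.length_le (hK : ∀ v ∈ K, par v ∈ K)
    (hnbr : ∀ v ∉ K, ∀ w, H.Adj v w → par v = w ∨ par w = v) {r u v : V} (hr : r ∈ K)
    (p : H.Walk u v) (hp : p.IsPath) {a b : ℕ} (hu : HangsBelow par K r a u)
    (hv : HangsBelow par K r b v) : p.length ≤ a + b := by
  induction p generalizing a with
  | nil => simp
  | @cons u w v h q ih =>
    cases a with
    | zero =>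
      have hur : u = r := hu.1
      subst hur
      have := hv.length_le_of_root hK hnbr hr (SimpleGraph.Walk.cons h q).reverse hp.reverse
      simpa using this
    | succ a =>
      rw [SimpleGraph.Walk.cons_isPath_iff] at hp
      rw [SimpleGraph.Walk.length_cons]
      rcases hnbr u hu.notMem w h with h1 | h1
      · have := ih hp.1 (h1 ▸ hu.parent) hv
        omega
      · have hw : w ∉ K := fun hw => hu.notMem (h1 ▸ hK w hw)
        have h2 := iterate_length_of_descending hK hnbr q hp.1 hw (h1 ▸ hp.2)
        have h3 : par^[q.length + 1] v = u := by rw [Function.iterate_succ_apply', h2, h1]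
        by_contra hlt
        have h4 : par^[q.length + 1] v ∈ K :=
          iterate_mem_of_closed hK (i := b) (by omega) (by rw [hv.1]; exact hr)
        exact hu.notMem (h3 ▸ h4)

end HangingTrees

/-! ### Saturated graphs with a dominating set within half the cycle length -/

section Counting

variable {V : Type*} {G H : SimpleGraph V} {m : ℕ}

/-- A breadth-first search forest with root set `R`: depths and parents. -/
theorem exists_bfs_forest {R : Finset V} {j : ℕ}
    (hdom : ∀ u, ∃ s ∈ R, ∃ p : H.Walk u s, p.length ≤ j) :
    ∃ d : V → ℕ, ∃ par : V → V, (∀ v, d v ≤ j) ∧ (∀ v, d v = 0 ↔ v ∈ R) ∧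
      (∀ v ∈ R, par v = v) ∧ ∀ v ∉ R, H.Adj v (par v) ∧ d (par v) + 1 = d v := by
  classical
  have hex : ∀ u, ∃ k, ∃ s ∈ R, ∃ p : H.Walk u s, p.length ≤ k := fun u => ⟨j, hdom u⟩
  set d : V → ℕ := fun u => Nat.find (hex u) with hd
  have hdle : ∀ u k, (∃ s ∈ R, ∃ p : H.Walk u s, p.length ≤ k) → d u ≤ k :=
    fun u k h => Nat.find_min' (hex u) h
  have hd0 : ∀ v, d v = 0 ↔ v ∈ R := fun v => by
    constructor
    · intro h
      obtain ⟨s, hs, p, hp⟩ := Nat.find_spec (hex v)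
      have : p.length = 0 := by
        change p.length ≤ d v at hp
        omega
      exact (SimpleGraph.Walk.eq_of_length_eq_zero this) ▸ hs
    · intro h
      exact Nat.le_zero.1 (hdle v 0 ⟨v, h, .nil, le_rfl⟩)
  have hpar : ∀ v, ∃ w, (v ∈ R → w = v) ∧ (v ∉ R → H.Adj v w ∧ d w + 1 = d v) := fun v => by
    by_cases hv : v ∈ R
    · exact ⟨v, fun _ => rfl, fun h => absurd hv h⟩
    · obtain ⟨s, hs, p, hp⟩ := Nat.find_spec (hex v)
      change p.length ≤ d v at hp
      cases p with
      | nil => exact absurd hs hv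
      | @cons _ w _ h q =>
        refine ⟨w, fun h => absurd h hv, fun _ => ⟨h, ?_⟩⟩
        rw [SimpleGraph.Walk.length_cons] at hp
        have h1 := hdle w (d v - 1) ⟨s, hs, q, by omega⟩
        obtain ⟨s', hs', q', hq'⟩ := Nat.find_spec (hex w)
        change q'.length ≤ d w at hq'
        have h2 := hdle v (d w + 1) ⟨s', hs', .cons h q', by simpa using hq'⟩
        omega
  choose par h1 h2 using hpar
  exact ⟨d, par, fun v => hdle v j (hdom v), hd0, h1, h2⟩

variable [Fintype V]

/-- The counting step of the lower bound. If every vertex is within distance `j < m / 2` of `R`,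
then the vertices off the core (the roots and the forest paths from the surplus edges to them)
hang in shallow trees, which are small because `m - 1` edges never fit inside one of them. -/
theorem card_le_of_dominated (hm : 5 ≤ m) (hsat : IsSaturatedIn (SimpleGraph.cycleGraph m) G H)
    {α : ℕ} (hα : ∀ S : Finset V, (∀ a ∈ S, ∀ b ∈ S, ¬ G.Adj a b) → #S ≤ α)
    {R : Finset V} {j : ℕ} (hj1 : 1 ≤ j) (hjm : 2 * j < m)
    (hdom : ∀ u, ∃ s ∈ R, ∃ p : H.Walk u s, p.length ≤ j) :
    ∃ k : ℕ, k + Fintype.card V = H.edgeSet.ncard + #R ∧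
      Fintype.card V ≤ #R + (2 * j * k + α * #R) * (2 * α) := by
  classical
  obtain ⟨d, par, hdj, hd0, hparR, hpar⟩ := exists_bfs_forest hdom
  have hdi : ∀ i v, d (par^[i] v) = d v - i := by
    intro i
    induction i with
    | zero => intro v; rfl
    | succ i ih =>
      intro v
      rw [Function.iterate_succ_apply']
      by_cases h : par^[i] v ∈ R
      · rw [hparR _ h, (hd0 _).2 h]
        have := ih v
        rw [(hd0 _).2 h] at this
        omega
      · have h1 := (hpar _ h).2
        have h2 := ih v
        omega
  have hitR : ∀ i v, d v ≤ i → par^[i] v ∈ R := fun i v h =>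
    (hd0 _).1 (by rw [hdi]; omega)
  -- the forest edges and the surplus edges
  set F : Finset (Sym2 V) := Rᶜ.image fun v => s(v, par v) with hF
  have hFcard : #F = #Rᶜ := by
    refine card_image_of_injOn fun v hv w hw he => ?_
    rw [mem_coe, mem_compl] at hv hw
    rcases Sym2.eq_iff.1 he with ⟨h, _⟩ | ⟨h1, h2⟩
    · exact h
    · have e1 := (hpar v hv).2
      have e2 := (hpar w hw).2
      rw [← h1] at e2
      rw [h2] at e1
      omega
  have hFH : F ⊆ H.edgeFinset := by
    intro e he
    obtain ⟨v, hv, rfl⟩ := mem_image.1 he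
    rw [mem_compl] at hv
    simpa using (hpar v hv).1
  set X := H.edgeFinset \ F with hX
  have hXcard : #X + #F = #H.edgeFinset := card_sdiff_add_card_eq_card hFH
  have hRc : #Rᶜ + #R = Fintype.card V := card_compl_add_card R
  have hncard : H.edgeSet.ncard = #H.edgeFinset := by
    rw [← SimpleGraph.coe_edgeFinset, Set.ncard_coe_finset]
  refine ⟨#X, by omega, ?_⟩
  set E : Finset V := X.biUnion fun e => univ.filter (· ∈ e) with hE
  have hEcard : #E ≤ 2 * #X := by
    rw [mul_comm]
    refine card_biUnion_le_card_mul _ _ _ fun e _ => ?_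
    induction e with
    | h a b =>
      refine (card_le_card (t := {a, b}) fun x hx => ?_).trans card_le_two
      simpa using hx
  -- the core
  set K₁ : Finset V := R ∪ (E ×ˢ range j).image fun x => par^[x.2] x.1 with hK₁
  have hRK₁ : R ⊆ K₁ := subset_union_left
  have hEK₁ : E ⊆ K₁ := fun v hv => mem_union_right _ <|
    mem_image.2 ⟨(v, 0), mem_product.2 ⟨hv, mem_range.2 (by omega)⟩, rfl⟩
  have hK₁cl : ∀ v ∈ (K₁ : Set V), par v ∈ (K₁ : Set V) := by
    intro v hv
    rw [mem_coe] at hv ⊢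
    rcases mem_union.1 hv with h | h
    · rw [hparR v h]; exact hv
    · obtain ⟨⟨w, i⟩, hwi, rfl⟩ := mem_image.1 h
      obtain ⟨hw, hi⟩ := mem_product.1 hwi
      rw [mem_range] at hi
      simp only
      rw [← Function.iterate_succ_apply' par i w]
      rcases Nat.lt_or_ge (i + 1) j with h1 | h1
      · exact mem_union_right _ <|
          mem_image.2 ⟨(w, i + 1), mem_product.2 ⟨hw, mem_range.2 h1⟩, rfl⟩
      · exact hRK₁ (hitR _ _ ((hdj w).trans h1))
  have hnbr₁ : ∀ v ∉ (K₁ : Set V), ∀ w, H.Adj v w → par v = w ∨ par w = v := by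
    intro v hv w hvw
    by_cases he : s(v, w) ∈ F
    · obtain ⟨x, _, hx⟩ := mem_image.1 he
      rcases Sym2.eq_iff.1 hx with ⟨rfl, h⟩ | ⟨rfl, h⟩
      · exact Or.inl h
      · exact Or.inr h
    · refine absurd (hEK₁ ?_) hv
      refine mem_biUnion.2 ⟨s(v, w), mem_sdiff.2 ⟨by simpa using hvw, he⟩, by simp⟩
  -- the children of the roots are added to the core, as trees below them could be too deep
  set K₂ : Finset V := K₁ ∪ univ.filter (fun v => v ∉ K₁ ∧ par v ∈ R) with hK₂
  have hK₁₂ : K₁ ⊆ K₂ := subset_union_left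
  have hchild : #(univ.filter fun v => v ∉ K₁ ∧ par v ∈ R) ≤ α * #R := by
    refine card_le_mul_card_image_of_maps_to (f := par) (fun v hv => (mem_filter.1 hv).2.2) α ?_
    intro r hr
    refine hα _ fun u hu v hv huv => ?_
    simp only [mem_filter, mem_univ, true_and] at hu hv
    by_cases hH : H.Adj u v
    · rcases hnbr₁ u (by simpa using hu.1.1) v hH with h | h
      · exact hv.1.1 (hRK₁ (h ▸ hu.1.2))
      · exact hu.1.1 (hRK₁ (h ▸ hv.1.2))
    · obtain ⟨p, hp, hl⟩ := hsat.exists_isPath (by omega) huv hH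
      have hb : ∀ x, x ∉ K₁ → par x = r → HangsBelow par (K₁ : Set V) r 1 x := fun x hx hxr =>
        ⟨hxr, fun i hi => by
          have : i = 0 := by omega
          subst this; simpa using hx⟩
      have := HangsBelow.length_le hK₁cl hnbr₁ (hRK₁ hr) p hp (hb u hu.1.1 hu.2)
        (hb v hv.1.1 hv.2)
      omega
  have hK₂card : #(K₂ \ R) ≤ 2 * j * #X + α * #R := by
    have h1 : K₂ \ R ⊆ ((E ×ˢ range j).image fun x => par^[x.2] x.1) ∪
        univ.filter (fun v => v ∉ K₁ ∧ par v ∈ R) := by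
      intro v hv
      obtain ⟨hvK, hvR⟩ := mem_sdiff.1 hv
      rcases mem_union.1 hvK with h | h
      · exact mem_union_left _ ((mem_union.1 h).resolve_left hvR)
      · exact mem_union_right _ h
    refine (card_le_card h1).trans ((card_union_le _ _).trans (add_le_add ?_ hchild))
    refine card_image_le.trans ?_
    rw [card_product, card_range]
    calc #E * j ≤ 2 * #X * j := Nat.mul_le_mul_right _ hEcard
      _ = 2 * j * #X := by ring
  have hK₂cl : ∀ v ∈ (K₂ : Set V), par v ∈ (K₂ : Set V) := by
    intro v hv
    rw [mem_coe] at hv ⊢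
    rcases mem_union.1 hv with h | h
    · exact hK₁₂ (hK₁cl v h)
    · exact hK₁₂ (hRK₁ (mem_filter.1 h).2.2)
  have hnbr₂ : ∀ v ∉ (K₂ : Set V), ∀ w, H.Adj v w → par v = w ∨ par w = v := fun v hv =>
    hnbr₁ v fun h => hv (hK₁₂ h)
  -- every vertex hangs below a unique core vertex
  have hroot : ∀ v, ∃ r ∈ K₂, ∃ a, HangsBelow par (K₂ : Set V) r a v := by
    intro v
    have hex : ∃ a, par^[a] v ∈ K₂ := ⟨j, hK₁₂ (hRK₁ (hitR _ _ (hdj v)))⟩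
    exact ⟨_, Nat.find_spec hex, Nat.find hex, rfl, fun i hi => by
      simpa using Nat.find_min hex hi⟩
  choose root hrootK depth hhang using hroot
  -- nothing hangs below a root, since its children belong to the core
  have hfibR : ∀ r ∈ R, #(univ.filter fun v => root v = r) ≤ 1 := by
    intro r hr
    refine card_le_one.2 fun u hu v hv => ?_
    have key : ∀ x, root x = r → x = r := by
      intro x hx
      have hb := hhang x
      rw [hx] at hb
      generalize depth x = a at hb
      cases a with
      | zero => exact hb.1
      | succ a =>
        have h1 := hb.2 a (by omega)
        refine absurd ?_ h1
        have h2 : par (par^[a] x) = r := by rw [← hb.1, Function.iterate_succ_apply']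
        by_cases h3 : par^[a] x ∈ K₁
        · exact hK₁₂ h3
        · exact mem_union_right _ (mem_filter.2 ⟨mem_univ _, h3, h2 ▸ hr⟩)
    rw [key u (mem_filter.1 hu).2, key v (mem_filter.1 hv).2]
  have hfib : ∀ r ∈ K₂ \ R, #(univ.filter fun v => root v = r) ≤ 2 * α := by
    intro r hr
    obtain ⟨hrK, hrR⟩ := mem_sdiff.1 hr
    have hdr : 1 ≤ d r := Nat.one_le_iff_ne_zero.2 fun h => hrR ((hd0 r).1 h)
    have hdep : ∀ v, root v = r → d v = d r + depth v := by
      intro v hv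
      have h1 := hdi (depth v) v
      rw [(hhang v).1, hv] at h1
      omega
    -- in a tree of depth at most `j - 1` the vertices of equal parity are independent in `G`: they
    -- are not adjacent in `H`, and a path between them has at most `2 * (j - 1) < m - 1` edges
    have hpart : ∀ c, #(univ.filter fun v => root v = r ∧ d v % 2 = c) ≤ α := by
      intro c
      refine hα _ fun u hu v hv huv => ?_
      simp only [mem_filter, mem_univ, true_and] at hu hv
      have hbu := hhang u
      have hbv := hhang v
      rw [hu.1] at hbu
      rw [hv.1] at hbv
      by_cases hH : H.Adj u v
      · have key : ∀ x y, root x = r → root y = r → d x % 2 = c → d y % 2 = c → H.Adj x y →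
            x ∉ K₂ → False := by
          intro x y hx hy hcx hcy hxy hxK
          rcases hnbr₂ x (by simpa using hxK) y hxy with h | h
          · have := (hpar x fun h => hxK (hK₁₂ (hRK₁ h))).2
            rw [h] at this
            omega
          · have hyK : y ∉ K₂ := fun hy => hxK (by simpa [h] using hK₂cl y hy)
            have := (hpar y fun h => hyK (hK₁₂ (hRK₁ h))).2
            rw [h] at this
            omega
        by_cases huK : u ∈ K₂
        · by_cases hvK : v ∈ K₂
          · have e : ∀ x, root x = r → x ∈ K₂ → x = r := by
              intro x hx hxK
              have hb := hhang x
              rw [hx] at hb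
              generalize depth x = a at hb
              cases a with
              | zero => exact hb.1
              | succ a => exact absurd hxK (by simpa using hb.notMem)
            exact huv.ne ((e u hu.1 huK).trans (e v hv.1 hvK).symm)
          · exact key v u hv.1 hu.1 hv.2 hu.2 hH.symm hvK
        · exact key u v hu.1 hv.1 hu.2 hv.2 hH huK
      · obtain ⟨p, hp, hl⟩ := hsat.exists_isPath (by omega) huv hH
        have h1 := HangsBelow.length_le hK₂cl hnbr₂ (by simpa using hrK) p hp hbu hbv
        have h2 := hdep u hu.1
        have h3 := hdep v hv.1
        have h4 := hdj u
        have h5 := hdj v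
        omega
    have hsub : (univ.filter fun v => root v = r) ⊆
        (univ.filter fun v => root v = r ∧ d v % 2 = 0) ∪
          univ.filter fun v => root v = r ∧ d v % 2 = 1 := by
      intro v hv
      have := (mem_filter.1 hv).2
      rw [mem_union, mem_filter, mem_filter]
      rcases Nat.mod_two_eq_zero_or_one (d v) with h | h
      · exact Or.inl ⟨mem_univ _, this, h⟩
      · exact Or.inr ⟨mem_univ _, this, h⟩
    refine (card_le_card hsub).trans ((card_union_le _ _).trans ?_)
    have := hpart 0
    have := hpart 1
    omega
  have htot : Fintype.card V = ∑ r ∈ K₂, #(univ.filter fun v => root v = r) := by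
    rw [← card_univ]
    exact card_eq_sum_card_fiberwise fun v _ => hrootK v
  have hRK₂ : R ⊆ K₂ := hRK₁.trans hK₁₂
  rw [htot, ← sum_sdiff hRK₂, add_comm]
  refine add_le_add ?_ ?_
  · simpa using sum_le_card_nsmul R _ 1 hfibR
  · refine (sum_le_card_nsmul _ _ _ hfib).trans ?_
    rw [smul_eq_mul]
    exact Nat.mul_le_mul_right _ hK₂card

end Counting

/-! ### Small dominating sets in saturated graphs -/

section Dominating

variable {V : Type*} [Fintype V] [DecidableEq V] {G H : SimpleGraph V} {m : ℕ}

/-- The ball around `v` in `H`, explored without passing through the vertices of `B`. -/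
def truncatedBall (H : SimpleGraph V) [DecidableRel H.Adj] (B : Finset V) (v : V) : ℕ → Finset V
  | 0 => {v}
  | i + 1 => truncatedBall H B v i ∪ (truncatedBall H B v i \ B).biUnion fun w => H.neighborFinset w

theorem truncatedBall_mono [DecidableRel H.Adj] (B : Finset V) (v : V) {i k : ℕ} (h : i ≤ k) :
    truncatedBall H B v i ⊆ truncatedBall H B v k := by
  induction h with
  | refl => exact le_rfl
  | step _ ih => exact ih.trans subset_union_left

theorem card_truncatedBall_le [DecidableRel H.Adj] {B : Finset V} {D : ℕ}
    (hB : ∀ w ∉ B, H.degree w ≤ D) (v : V) (i : ℕ) :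
    #(truncatedBall H B v i) ≤ (D + 1) ^ i := by
  induction i with
  | zero => simp [truncatedBall]
  | succ i ih =>
    refine (card_union_le _ _).trans ?_
    have h1 : #((truncatedBall H B v i \ B).biUnion fun w => H.neighborFinset w) ≤
        #(truncatedBall H B v i) * D := by
      refine (card_biUnion_le_card_mul _ _ D fun w hw => ?_).trans
        (Nat.mul_le_mul_right _ (card_le_card sdiff_subset))
      exact hB w (mem_sdiff.1 hw).2
    calc _ ≤ #(truncatedBall H B v i) + #(truncatedBall H B v i) * D := by omega
      _ = #(truncatedBall H B v i) * (D + 1) := by ring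
      _ ≤ (D + 1) ^ i * (D + 1) := Nat.mul_le_mul_right _ ih
      _ = _ := (pow_succ _ _).symm

/-- A walk that has avoided `B` so far is still in the truncated ball. -/
theorem getVert_mem_truncatedBall [DecidableRel H.Adj] {B : Finset V} {v u : V} (p : H.Walk v u)
    {i : ℕ} (hi : i ≤ p.length) (h : ∀ k < i, p.getVert k ∉ B) :
    p.getVert i ∈ truncatedBall H B v i := by
  induction i with
  | zero => simp [truncatedBall]
  | succ i ih =>
    refine mem_union_right _ (mem_biUnion.2 ⟨p.getVert i, ?_, ?_⟩)
    · exact mem_sdiff.2 ⟨ih (by omega) fun k hk => h k (by omega), h i (by omega)⟩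
    · simpa using p.adj_getVert_succ (by omega)

/-- In a saturated graph few vertices dominate everything within half the cycle length. Besides
the vertices of degree above `D` they are taken from truncated balls around `t` vertices that are
far from all high degrees: the middle of a path with `m - 1` edges from such a vertex lies in its
ball, and these `t` vertices see almost all the vertices in `G`. -/
theorem exists_dominating (hm : 5 ≤ m) (hsat : IsSaturatedIn (SimpleGraph.cycleGraph m) G H)
    [DecidableRel H.Adj] {t : ℕ} (hG : ∀ A B : Finset V, Disjoint A B → t ≤ #A → t ≤ #B →
      ∃ a ∈ A, ∃ b ∈ B, G.Adj a b) (D : ℕ) {j : ℕ} (hj1 : 2 * j < m) (hj2 : m ≤ 2 * j + 2) :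
    ∃ R : Finset V, #R ≤ #(univ.filter fun v => D < H.degree v) + t + t * (D + 1) ^ (j + 1) ∧
      ∀ u, ∃ s ∈ R, ∃ p : H.Walk u s, p.length ≤ j := by
  classical
  set B := univ.filter fun v => D < H.degree v with hB
  have hBdeg : ∀ w ∉ B, H.degree w ≤ D := fun w hw => by simpa [hB] using hw
  set U := univ.filter fun u => ∀ s ∈ B, ∀ p : H.Walk u s, j < p.length with hU
  have hnotU : ∀ u ∉ U, ∃ s ∈ B, ∃ p : H.Walk u s, p.length ≤ j := fun u hu => by
    simpa [hU] using hu
  rcases Nat.lt_or_ge #U t with hUt | hUt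
  · refine ⟨B ∪ U, (card_union_le _ _).trans (by omega), fun u => ?_⟩
    by_cases hu : u ∈ U
    · exact ⟨u, mem_union_right _ hu, .nil, Nat.zero_le _⟩
    · obtain ⟨s, hs, h⟩ := hnotU u hu
      exact ⟨s, mem_union_left _ hs, h⟩
  · obtain ⟨T, hTU, hT⟩ := exists_subset_card_eq hUt
    -- the vertices that `T` does not see in `G`
    set Z := univ.filter fun u => u ∉ T ∧ ∀ v ∈ T, ¬ G.Adj v u with hZ
    have hZt : #Z ≤ t := by
      by_contra hlt
      obtain ⟨a, ha, b, hb, hab⟩ := hG T Z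
        (disjoint_left.2 fun x hx hxZ => (mem_filter.1 hxZ).2.1 hx) hT.ge (by omega)
      exact (mem_filter.1 hb).2.2 a ha hab
    refine ⟨B ∪ Z ∪ T.biUnion fun v => truncatedBall H B v (j + 1), ?_, fun u => ?_⟩
    · refine (card_union_le _ _).trans (add_le_add ((card_union_le _ _).trans (by omega)) ?_)
      rw [← hT]
      exact card_biUnion_le_card_mul _ _ _ fun v _ => card_truncatedBall_le hBdeg v _
    · by_cases hu : u ∈ U
      swap
      · obtain ⟨s, hs, h⟩ := hnotU u hu
        exact ⟨s, mem_union_left _ (mem_union_left _ hs), h⟩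
      by_cases huT : u ∈ T
      · refine ⟨u, mem_union_right _ (mem_biUnion.2 ⟨u, huT, ?_⟩), .nil, Nat.zero_le _⟩
        exact truncatedBall_mono B u (Nat.zero_le _) (by simp [truncatedBall])
      by_cases huZ : u ∈ Z
      · exact ⟨u, mem_union_left _ (mem_union_right _ huZ), .nil, Nat.zero_le _⟩
      obtain ⟨v, hvT, hvu⟩ : ∃ v ∈ T, G.Adj v u := by
        by_contra hcon
        push Not at hcon
        exact huZ (mem_filter.2 ⟨mem_univ _, huT, hcon⟩)
      have hvU : ∀ s ∈ B, ∀ p : H.Walk v s, j < p.length := (mem_filter.1 (hTU hvT)).2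
      by_cases hH : H.Adj v u
      · refine ⟨u, mem_union_right _ (mem_biUnion.2 ⟨v, hvT, ?_⟩), .nil, Nat.zero_le _⟩
        refine truncatedBall_mono B v (i := 1) (by omega) (mem_union_right _ ?_)
        refine mem_biUnion.2 ⟨v, mem_sdiff.2 ⟨by simp [truncatedBall], fun hvB => ?_⟩, by simpa⟩
        have := hvU v hvB .nil
        simp at this
      · obtain ⟨p, -, hl⟩ := hsat.exists_isPath (by omega) hvu hH
        refine ⟨p.getVert (j + 1), mem_union_right _ (mem_biUnion.2 ⟨v, hvT, ?_⟩),
          (p.drop (j + 1)).reverse, ?_⟩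
        · refine getVert_mem_truncatedBall p (by omega) fun k hk hkB => ?_
          have h1 := hvU _ hkB (p.take k)
          rw [SimpleGraph.Walk.take_length] at h1
          omega
        · rw [SimpleGraph.Walk.length_reverse, SimpleGraph.Walk.drop_length]
          omega

/-- The lower bound on the size of a saturated graph, before the asymptotics. -/
theorem card_le_of_isSaturatedIn (hm : 5 ≤ m)
    (hsat : IsSaturatedIn (SimpleGraph.cycleGraph m) G H) {α t : ℕ}
    (hα : ∀ S : Finset V, (∀ a ∈ S, ∀ b ∈ S, ¬ G.Adj a b) → #S ≤ α)
    (hG : ∀ A B : Finset V, Disjoint A B → t ≤ #A → t ≤ #B → ∃ a ∈ A, ∃ b ∈ B, G.Adj a b)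
    (D : ℕ) :
    ∃ k r b : ℕ, k + Fintype.card V = H.edgeSet.ncard + r ∧ b * D ≤ 2 * H.edgeSet.ncard ∧
      r ≤ b + t + t * (D + 1) ^ m ∧
      Fintype.card V ≤ r + ((m - 1) * k + α * r) * (2 * α) := by
  classical
  obtain ⟨R, hR, hdom⟩ := exists_dominating hm hsat hG D (j := (m - 1) / 2) (by omega) (by omega)
  obtain ⟨k, hk, hcard⟩ := card_le_of_dominated hm hsat hα (j := (m - 1) / 2) (by omega) (by omega)
    hdom
  refine ⟨k, #R, #(univ.filter fun v => D < H.degree v), hk, ?_, hR.trans ?_, hcard.trans ?_⟩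
  · have h1 := H.sum_degrees_eq_twice_card_edges
    have h2 : H.edgeSet.ncard = #H.edgeFinset := by
      rw [← SimpleGraph.coe_edgeFinset, Set.ncard_coe_finset]
    rw [h2, ← h1, ← smul_eq_mul]
    refine (card_nsmul_le_sum _ (fun v => H.degree v) D fun v hv => ?_).trans
      (sum_le_sum_of_subset (filter_subset _ _))
    exact (mem_filter.1 hv).2.le
  · gcongr <;> omega
  · gcongr
    omega

end Dominating

/-! ### Sparse saturated graphs from hubs around a clique -/

section CliquePath

variable {V : Type*} [DecidableEq V] {H : SimpleGraph V}

/-- A clique contains paths of all possible lengths between any two of its vertices. -/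
theorem exists_isPath_of_clique (l : ℕ) : ∀ {S : Finset V}
    (_ : ∀ u ∈ S, ∀ v ∈ S, u ≠ v → H.Adj u v) {x y : V} (_ : x ∈ S) (_ : y ∈ S) (_ : x ≠ y)
    (_ : l + 1 < #S),
    ∃ p : H.Walk x y, p.IsPath ∧ p.length = l + 1 ∧ ∀ z ∈ p.support, z ∈ S := by
  induction l with
  | zero =>
    intro S hS x y hx hy hxy _
    refine ⟨.cons (hS x hx y hy hxy) .nil, ?_, rfl, ?_⟩
    · simp [SimpleGraph.Walk.cons_isPath_iff, hxy]
    · simp [hx, hy]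
  | succ l ih =>
    intro S hS x y hx hy hxy hl
    obtain ⟨z, hz⟩ : ((S.erase x).erase y).Nonempty := by
      rw [← card_pos, card_erase_of_mem (mem_erase.2 ⟨hxy.symm, hy⟩), card_erase_of_mem hx]
      omega
    rw [mem_erase, mem_erase] at hz
    obtain ⟨hzy, hzx, hzS⟩ := hz
    obtain ⟨p, hp, hlen, hsup⟩ := ih (S := S.erase x)
      (fun u hu v hv => hS u (mem_of_mem_erase hu) v (mem_of_mem_erase hv))
      (mem_erase.2 ⟨hzx, hzS⟩) (mem_erase.2 ⟨hxy.symm, hy⟩) hzy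
      (by rw [card_erase_of_mem hx]; omega)
    refine ⟨.cons (hS x hx z hzS hzx.symm) p, ?_, by simp [hlen], ?_⟩
    · rw [SimpleGraph.Walk.cons_isPath_iff]
      exact ⟨hp, fun h => by simpa using hsup x h⟩
    · intro w hw
      rw [SimpleGraph.Walk.support_cons, List.mem_cons] at hw
      rcases hw with rfl | hw
      · exact hx
      · exact mem_of_mem_erase (hsup w hw)

end CliquePath

/-- A blueprint for a sparse `C_m`-saturated graph in `G`: a clique `Q` on `m - 2` vertices, a set
`A` of hubs, all adjacent to the two vertices `c₁` and `c₂` of `Q`, and an assignment `f` of every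
other vertex to an adjacent hub such that vertices with the same hub are not adjacent. -/
structure HubSystem {V : Type*} (G : SimpleGraph V) (m : ℕ) where
  Q : Finset V
  A : Finset V
  c₁ : V
  c₂ : V
  f : V → V
  adj_of_mem : ∀ u ∈ Q, ∀ v ∈ Q, u ≠ v → G.Adj u v
  card_Q : #Q + 2 = m
  mem₁ : c₁ ∈ Q
  mem₂ : c₂ ∈ Q
  ne : c₁ ≠ c₂
  disj : Disjoint Q A
  adj₁ : ∀ a ∈ A, G.Adj a c₁
  adj₂ : ∀ a ∈ A, G.Adj a c₂
  two_le : 2 ≤ #A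
  f_mem : ∀ v, v ∉ Q → v ∉ A → f v ∈ A
  adj_f : ∀ v, v ∉ Q → v ∉ A → G.Adj v (f v)
  indep : ∀ u v, u ∉ Q → u ∉ A → v ∉ Q → v ∉ A → f u = f v → ¬ G.Adj u v

namespace HubSystem

variable {V : Type*} {G : SimpleGraph V} {m : ℕ} (S : HubSystem G m)

/-- The graph described by the blueprint. -/
def graph : SimpleGraph V :=
  SimpleGraph.fromRel fun u v => (u ∈ S.Q ∧ v ∈ S.Q) ∨ (u ∈ S.A ∧ (v = S.c₁ ∨ v = S.c₂)) ∨
    (u ∉ S.Q ∧ u ∉ S.A ∧ v = S.f u)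

theorem graph_le : S.graph ≤ G := by
  have key : ∀ u v, u ≠ v → ((u ∈ S.Q ∧ v ∈ S.Q) ∨ (u ∈ S.A ∧ (v = S.c₁ ∨ v = S.c₂)) ∨
      (u ∉ S.Q ∧ u ∉ S.A ∧ v = S.f u)) → G.Adj u v := by
    rintro u v hne (h | ⟨h, rfl | rfl⟩ | ⟨h1, h2, rfl⟩)
    · exact S.adj_of_mem u h.1 v h.2 hne
    · exact S.adj₁ u h
    · exact S.adj₂ u h
    · exact S.adj_f u h1 h2
  intro u v huv
  rw [graph, SimpleGraph.fromRel_adj] at huv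
  rcases huv.2 with h | h
  · exact key u v huv.1 h
  · exact (key v u huv.1.symm h).symm

theorem graph_adj_Q {u v : V} (hu : u ∈ S.Q) (hv : v ∈ S.Q) (h : u ≠ v) : S.graph.Adj u v :=
  (SimpleGraph.fromRel_adj ..).2 ⟨h, Or.inl (Or.inl ⟨hu, hv⟩)⟩

theorem graph_adj_c₁ {a : V} (ha : a ∈ S.A) : S.graph.Adj a S.c₁ :=
  (SimpleGraph.fromRel_adj ..).2 ⟨fun h => disjoint_left.1 S.disj S.mem₁ (h ▸ ha),
    Or.inl (Or.inr (Or.inl ⟨ha, Or.inl rfl⟩))⟩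

theorem graph_adj_c₂ {a : V} (ha : a ∈ S.A) : S.graph.Adj a S.c₂ :=
  (SimpleGraph.fromRel_adj ..).2 ⟨fun h => disjoint_left.1 S.disj S.mem₂ (h ▸ ha),
    Or.inl (Or.inr (Or.inl ⟨ha, Or.inr rfl⟩))⟩

theorem graph_adj_f {v : V} (hQ : v ∉ S.Q) (hA : v ∉ S.A) : S.graph.Adj v (S.f v) :=
  (SimpleGraph.fromRel_adj ..).2 ⟨(S.adj_f v hQ hA).ne, Or.inl (Or.inr (Or.inr ⟨hQ, hA, rfl⟩))⟩

theorem eq_f_of_adj {v w : V} (hQ : v ∉ S.Q) (hA : v ∉ S.A) (h : S.graph.Adj v w) :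
    w = S.f v := by
  rw [graph, SimpleGraph.fromRel_adj] at h
  rcases h.2 with (h | h | h) | (h | ⟨_, rfl | rfl⟩ | ⟨h1, h2, rfl⟩)
  · exact absurd h.1 hQ
  · exact absurd h.1 hA
  · exact h.2.2
  · exact absurd h.2 hQ
  · exact absurd S.mem₁ hQ
  · exact absurd S.mem₂ hQ
  · exact absurd (S.f_mem w h1 h2) hA

theorem eq_of_hub_adj {a w : V} (ha : a ∈ S.A) (hw : w ∈ S.Q ∨ w ∈ S.A) (h : S.graph.Adj a w) :
    w = S.c₁ ∨ w = S.c₂ := by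
  have haQ : a ∉ S.Q := fun h => disjoint_left.1 S.disj h ha
  rw [graph, SimpleGraph.fromRel_adj] at h
  rcases h.2 with (h | h | h) | (h | ⟨_, rfl | rfl⟩ | ⟨h1, h2, rfl⟩)
  · exact absurd h.1 haQ
  · exact h.2
  · exact absurd ha h.2.1
  · exact absurd h.2 haQ
  · exact absurd S.mem₁ haQ
  · exact absurd S.mem₂ haQ
  · tauto

/-- A copy of `C_m` would avoid the vertices of degree one. Any hub on it lies between `c₁` and
`c₂`, so two hubs would give a 4-cycle, and with at most one hub there are too few vertices. -/
theorem free (hm : 5 ≤ m) : (SimpleGraph.cycleGraph m).Free S.graph := by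
  classical
  rintro ⟨φ⟩
  obtain ⟨n, rfl⟩ : ∃ n, m = n + 5 := ⟨m - 5, by omega⟩
  have hφ : Function.Injective φ := φ.injective
  have hnext : ∀ i, S.graph.Adj (φ i) (φ (i + 1)) := fun i =>
    φ.toHom.map_adj (SimpleGraph.cycleGraph_adj.2 (Or.inr (by simp)))
  have hprev : ∀ i, S.graph.Adj (φ i) (φ (i - 1)) := fun i =>
    φ.toHom.map_adj (SimpleGraph.cycleGraph_adj.2 (Or.inl (by simp)))
  -- the two neighbours of a vertex on the cycle differ, and no two vertices have both in common
  have h2 : ∀ i : Fin (n + 5), i + 1 ≠ i - 1 := by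
    intro i h
    have h' : (1 : Fin (n + 5)) + 1 = 0 := by
      have := congrArg (fun x => x - i + 1) h
      simpa using this
    simp [Fin.ext_iff, Fin.val_add] at h'
    rw [Nat.mod_eq_of_lt (by omega)] at h'
    omega
  have h4 : ∀ i k : Fin (n + 5), i + 1 = k - 1 → i - 1 = k + 1 → False := by
    intro i k h h'
    have hk : k = i + 1 + 1 := by rw [h]; simp
    have h' : (1 : Fin (n + 5)) + 1 + 1 + 1 = 0 := by
      rw [hk] at h'
      have := congrArg (fun x => x - i + 1) h'
      simp only [sub_sub_cancel_left] at this
      have e : i + 1 + 1 + 1 - i + 1 = 1 + 1 + 1 + 1 := by abel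
      rw [← e, ← this]
      abel
    simp [Fin.ext_iff, Fin.val_add] at h'
    rw [Nat.mod_eq_of_lt (by omega)] at h'
    omega
  have hleaf : ∀ i, φ i ∈ S.Q ∨ φ i ∈ S.A := by
    intro i
    by_contra hcon
    push Not at hcon
    exact h2 i (hφ ((S.eq_f_of_adj hcon.1 hcon.2 (hnext i)).trans
      (S.eq_f_of_adj hcon.1 hcon.2 (hprev i)).symm))
  have hone : #(univ.filter fun i => φ i ∈ S.A) ≤ 1 := by
    refine card_le_one.2 fun i hi k hk => ?_
    rw [mem_filter] at hi hk
    have a1 := S.eq_of_hub_adj hi.2 (hleaf _) (hnext i)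
    have a2 := S.eq_of_hub_adj hi.2 (hleaf _) (hprev i)
    have b1 := S.eq_of_hub_adj hk.2 (hleaf _) (hnext k)
    have b2 := S.eq_of_hub_adj hk.2 (hleaf _) (hprev k)
    have ha : φ (i + 1) ≠ φ (i - 1) := fun h => h2 i (hφ h)
    have hb : φ (k + 1) ≠ φ (k - 1) := fun h => h2 k (hφ h)
    by_cases hsame : φ (i + 1) = φ (k + 1)
    · exact add_right_cancel (hφ hsame)
    · have e1 : φ (i + 1) = φ (k - 1) := by
        rcases a1 with h | h <;> rcases b1 with h' | h' <;> rcases b2 with h'' | h'' <;> simp_all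
      have e2 : φ (i - 1) = φ (k + 1) := by
        rcases a1 with h | h <;> rcases b1 with h' | h' <;> rcases a2 with h'' | h'' <;> simp_all
      exact (h4 i k (hφ e1) (hφ e2)).elim
  have hQ : #(univ.filter fun i => φ i ∈ S.Q) ≤ #S.Q :=
    card_le_card_of_injOn φ (fun i hi => (mem_filter.1 hi).2) hφ.injOn
  have htot : #(univ : Finset (Fin (n + 5))) ≤
      #(univ.filter fun i => φ i ∈ S.Q) + #(univ.filter fun i => φ i ∈ S.A) := by
    refine (card_le_card fun i _ => ?_).trans (card_union_le _ _)
    rw [mem_union, mem_filter, mem_filter]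
    rcases hleaf i with h | h
    · exact Or.inl ⟨mem_univ _, h⟩
    · exact Or.inr ⟨mem_univ _, h⟩
  rw [card_univ, Fintype.card_fin] at htot
  have := S.card_Q
  omega

/-- Two hubs are joined through `Q` by paths with `l` edges, for all `2 ≤ l < m`. -/
theorem exists_hub_path [DecidableEq V] {a b : V} (ha : a ∈ S.A) (hb : b ∈ S.A)
    (hab : a ≠ b) {l : ℕ} (hl2 : 2 ≤ l) (hlm : l + 1 ≤ m) :
    ∃ p : S.graph.Walk a b, p.IsPath ∧ p.length = l ∧ ∀ z ∈ p.support, z ∈ S.Q ∨ z ∈ S.A := by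
  have haQ : a ∉ S.Q := fun h => disjoint_left.1 S.disj h ha
  have hbQ : b ∉ S.Q := fun h => disjoint_left.1 S.disj h hb
  obtain ⟨l, rfl⟩ : ∃ k, l = k + 2 := ⟨l - 2, by omega⟩
  cases l with
  | zero =>
    refine ⟨.cons (S.graph_adj_c₁ ha) (.cons (S.graph_adj_c₁ hb).symm .nil), ?_, rfl, ?_⟩
    · have h1 : a ≠ S.c₁ := fun h => haQ (h ▸ S.mem₁)
      have h2 : S.c₁ ≠ b := fun h => hbQ (h ▸ S.mem₁)
      simp [SimpleGraph.Walk.cons_isPath_iff, hab, h1, h2]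
    · simp [ha, hb, S.mem₁]
  | succ l =>
    obtain ⟨p, hp, hlen, hsup⟩ := exists_isPath_of_clique (H := S.graph) l
      (fun u hu v hv => S.graph_adj_Q hu hv) S.mem₁ S.mem₂ S.ne (by have := S.card_Q; omega)
    have hbp : b ∉ p.support := fun h => hbQ (hsup b h)
    refine ⟨.cons (S.graph_adj_c₁ ha) (p.concat (S.graph_adj_c₂ hb).symm), ?_, by simp [hlen], ?_⟩
    · rw [SimpleGraph.Walk.cons_isPath_iff]
      refine ⟨hp.concat hbp _, ?_⟩
      rw [SimpleGraph.Walk.support_concat]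
      simp only [List.mem_append, List.mem_singleton, not_or]
      exact ⟨fun h => haQ (hsup a h), hab⟩
    · intro z hz
      rw [SimpleGraph.Walk.support_cons, SimpleGraph.Walk.support_concat] at hz
      simp only [List.mem_cons, List.mem_append] at hz
      rcases hz with rfl | hz | rfl | h
      · exact Or.inr ha
      · exact Or.inl (hsup z hz)
      · exact Or.inr hb
      · exact absurd h (by simp)

/-- A hub and a vertex of `Q` are joined by a path with `m - 2` edges. -/
theorem exists_clique_path [DecidableEq V] (hm : 5 ≤ m) {a y : V} (ha : a ∈ S.A) (hy : y ∈ S.Q) :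
    ∃ p : S.graph.Walk a y, p.IsPath ∧ p.length + 2 = m ∧
      ∀ z ∈ p.support, z ∈ S.Q ∨ z ∈ S.A := by
  have haQ : a ∉ S.Q := fun h => disjoint_left.1 S.disj h ha
  obtain ⟨c, hcQ, hac, hcy⟩ : ∃ c ∈ S.Q, S.graph.Adj a c ∧ c ≠ y := by
    by_cases h : S.c₁ = y
    · exact ⟨S.c₂, S.mem₂, S.graph_adj_c₂ ha, fun h' => S.ne (h.trans h'.symm)⟩
    · exact ⟨S.c₁, S.mem₁, S.graph_adj_c₁ ha, h⟩
  obtain ⟨p, hp, hlen, hsup⟩ := exists_isPath_of_clique (H := S.graph) (m - 4)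
    (fun u hu v hv => S.graph_adj_Q hu hv) hcQ hy hcy (by have := S.card_Q; omega)
  refine ⟨.cons hac p, ?_, by simp [hlen]; omega, ?_⟩
  · rw [SimpleGraph.Walk.cons_isPath_iff]
    exact ⟨hp, fun h => haQ (hsup a h)⟩
  · intro z hz
    rw [SimpleGraph.Walk.support_cons, List.mem_cons] at hz
    rcases hz with rfl | hz
    · exact Or.inr ha
    · exact Or.inl (hsup z hz)

/-- Missing edges of `G` are bridged by paths with `m - 1` edges. The clique supplies paths of every
length between `c₁` and `c₂`, and the vertices of degree one are entered through their hubs. For a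
hub and a vertex of `Q` the path makes a detour `c₁, b, c₂` through a second hub `b`. -/
theorem exists_isPath_of_not_adj (hm : 5 ≤ m) {u v : V} (huv : G.Adj u v)
    (hn : ¬ S.graph.Adj u v) : ∃ p : S.graph.Walk u v, p.IsPath ∧ p.length + 1 = m := by
  classical
  have sym : ∀ {x y : V}, (∃ p : S.graph.Walk x y, p.IsPath ∧ p.length + 1 = m) →
      ∃ p : S.graph.Walk y x, p.IsPath ∧ p.length + 1 = m := fun ⟨p, hp, hl⟩ =>
    ⟨p.reverse, hp.reverse, by simpa using hl⟩
  have hubhub : ∀ a ∈ S.A, ∀ b ∈ S.A, a ≠ b →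
      ∃ p : S.graph.Walk a b, p.IsPath ∧ p.length + 1 = m := by
    intro a ha b hb hab
    obtain ⟨p, hp, hl, -⟩ := S.exists_hub_path ha hb hab (l := m - 1) (by omega) (by omega)
    exact ⟨p, hp, by omega⟩
  have hubQ : ∀ a ∈ S.A, ∀ y ∈ S.Q, ¬ S.graph.Adj a y →
      ∃ p : S.graph.Walk a y, p.IsPath ∧ p.length + 1 = m := by
    intro a ha y hy hay
    have haQ : a ∉ S.Q := fun h => disjoint_left.1 S.disj h ha
    have hy1 : y ≠ S.c₁ := fun h => hay (h ▸ S.graph_adj_c₁ ha)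
    have hy2 : y ≠ S.c₂ := fun h => hay (h ▸ S.graph_adj_c₂ ha)
    obtain ⟨b, hb, hba⟩ := exists_mem_ne (s := S.A) (by have := S.two_le; omega) a
    have hbQ : b ∉ S.Q := fun h => disjoint_left.1 S.disj h hb
    obtain ⟨p, hp, hlen, hsup⟩ := exists_isPath_of_clique (H := S.graph) (S := S.Q.erase S.c₁)
      (m - 5) (fun u hu v hv => S.graph_adj_Q (mem_of_mem_erase hu) (mem_of_mem_erase hv))
      (mem_erase.2 ⟨S.ne.symm, S.mem₂⟩) (mem_erase.2 ⟨hy1, hy⟩) hy2.symm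
      (by rw [card_erase_of_mem S.mem₁]; have := S.card_Q; omega)
    have hc₁p : S.c₁ ∉ p.support := fun h => by simpa using hsup _ h
    have hpQ : ∀ z ∈ p.support, z ∈ S.Q := fun z hz => mem_of_mem_erase (hsup z hz)
    refine ⟨.cons (S.graph_adj_c₁ ha) (.cons (S.graph_adj_c₁ hb).symm
      (.cons (S.graph_adj_c₂ hb) p)), ?_, by simp [hlen]; omega⟩
    simp only [SimpleGraph.Walk.cons_isPath_iff, SimpleGraph.Walk.support_cons, List.mem_cons,
      not_or]
    exact ⟨⟨⟨hp, fun h => hbQ (hpQ b h)⟩, fun h => hbQ (h ▸ S.mem₁), hc₁p⟩,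
      fun h => haQ (h ▸ S.mem₁), fun h => hba h.symm, fun h => haQ (hpQ a h)⟩
  have ext : ∀ u, u ∉ S.Q → u ∉ S.A → ∀ x, ∀ p : S.graph.Walk (S.f u) x, p.IsPath →
      (∀ z ∈ p.support, z ≠ u) →
      ∃ p' : S.graph.Walk u x, p'.IsPath ∧ p'.length = p.length + 1 ∧
        ∀ z ∈ p'.support, z = u ∨ z ∈ p.support := by
    intro u hQ hA x p hp hu
    refine ⟨.cons (S.graph_adj_f hQ hA) p, ?_, rfl, by simp⟩
    rw [SimpleGraph.Walk.cons_isPath_iff]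
    exact ⟨hp, fun h => hu u h rfl⟩
  have core : ∀ u, u ∉ S.Q → u ∉ S.A → ∀ z, z ∈ S.Q ∨ z ∈ S.A → z ≠ u := by
    rintro u hQ hA z (h | h) rfl
    · exact hQ h
    · exact hA h
  have leafhub : ∀ u, u ∉ S.Q → u ∉ S.A → ∀ b ∈ S.A, ¬ S.graph.Adj u b →
      ∃ p : S.graph.Walk u b, p.IsPath ∧ p.length + 1 = m := by
    intro u hQ hA b hb hub
    obtain ⟨p, hp, hl, hs⟩ := S.exists_hub_path (S.f_mem u hQ hA) hb
      (fun h => hub (h ▸ S.graph_adj_f hQ hA)) (l := m - 2) (by omega) (by omega)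
    obtain ⟨p', hp', hl', -⟩ := ext u hQ hA b p hp fun z hz => core u hQ hA z (hs z hz)
    exact ⟨p', hp', by omega⟩
  have leafQ : ∀ u, u ∉ S.Q → u ∉ S.A → ∀ y ∈ S.Q,
      ∃ p : S.graph.Walk u y, p.IsPath ∧ p.length + 1 = m := by
    intro u hQ hA y hy
    obtain ⟨p, hp, hl, hs⟩ := S.exists_clique_path hm (S.f_mem u hQ hA) hy
    obtain ⟨p', hp', hl', -⟩ := ext u hQ hA y p hp fun z hz => core u hQ hA z (hs z hz)
    exact ⟨p', hp', by omega⟩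
  by_cases hu : u ∈ S.Q
  · by_cases hv : v ∈ S.Q
    · exact absurd (S.graph_adj_Q hu hv huv.ne) hn
    by_cases hvA : v ∈ S.A
    · exact sym (hubQ v hvA u hu fun h => hn h.symm)
    · exact sym (leafQ v hv hvA u hu)
  by_cases huA : u ∈ S.A
  · by_cases hv : v ∈ S.Q
    · exact hubQ u huA v hv hn
    by_cases hvA : v ∈ S.A
    · exact hubhub u huA v hvA huv.ne
    · exact sym (leafhub v hv hvA u huA fun h => hn h.symm)
  by_cases hv : v ∈ S.Q
  · exact leafQ u hu huA v hv
  by_cases hvA : v ∈ S.A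
  · exact leafhub u hu huA v hvA hn
  · have hne : S.f u ≠ S.f v := fun h => S.indep u v hu huA hv hvA h huv
    obtain ⟨p, hp, hl, hs⟩ := S.exists_hub_path (S.f_mem u hu huA) (S.f_mem v hv hvA) hne
      (l := m - 3) (by omega) (by omega)
    obtain ⟨p', hp', hl', hs'⟩ := ext u hu huA _ p hp fun z hz => core u hu huA z (hs z hz)
    obtain ⟨p'', hp'', hl'', -⟩ := ext v hv hvA u p'.reverse hp'.reverse fun z hz => by
      rw [SimpleGraph.Walk.support_reverse, List.mem_reverse] at hz
      rcases hs' z hz with rfl | h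
      · exact huv.ne
      · exact core v hv hvA z (hs z h)
    refine sym ⟨p'', hp'', ?_⟩
    rw [SimpleGraph.Walk.length_reverse] at hl''
    omega

theorem isSaturatedIn (hm : 5 ≤ m) : IsSaturatedIn (SimpleGraph.cycleGraph m) G S.graph := by
  refine ⟨⟨S.graph_le, S.free hm⟩, fun K hK hle u v huv => ?_⟩
  by_contra hn
  obtain ⟨p, hp, hl⟩ := S.exists_isPath_of_not_adj hm (hK.1 huv) hn
  exact hK.2 (cycleGraph_isContained_of_isPath (by omega) hle huv hn hp hl)

/-- Every vertex off the clique contributes one edge, and every hub a second one. -/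
theorem ncard_edgeSet_le [Fintype V] :
    S.graph.edgeSet.ncard ≤ Fintype.card V + #S.A + m ^ 2 := by
  classical
  set E : Finset (Sym2 V) := ((S.Q ×ˢ S.Q).image fun x => s(x.1, x.2)) ∪
    (S.A.image fun a => s(a, S.c₁)) ∪ (S.A.image fun a => s(a, S.c₂)) ∪
    ((S.Q ∪ S.A)ᶜ.image fun v => s(v, S.f v)) with hE
  have key : ∀ u v, ((u ∈ S.Q ∧ v ∈ S.Q) ∨ (u ∈ S.A ∧ (v = S.c₁ ∨ v = S.c₂)) ∨
      (u ∉ S.Q ∧ u ∉ S.A ∧ v = S.f u)) → s(u, v) ∈ E := by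
    rintro u v (h | ⟨h, rfl | rfl⟩ | ⟨h1, h2, rfl⟩)
    · exact mem_union_left _ <| mem_union_left _ <| mem_union_left _ <|
        mem_image.2 ⟨(u, v), mem_product.2 h, rfl⟩
    · exact mem_union_left _ <| mem_union_left _ <| mem_union_right _ <| mem_image.2 ⟨u, h, rfl⟩
    · exact mem_union_left _ <| mem_union_right _ <| mem_image.2 ⟨u, h, rfl⟩
    · exact mem_union_right _ <| mem_image.2 ⟨u, by simp [h1, h2], rfl⟩
  have hsub : S.graph.edgeSet ⊆ E := by
    intro e he
    induction e with
    | h u v =>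
      rw [SimpleGraph.mem_edgeSet, graph, SimpleGraph.fromRel_adj] at he
      rcases he.2 with h | h
      · exact key u v h
      · rw [Sym2.eq_swap]; exact key v u h
  have h1 := Set.ncard_le_ncard hsub (Set.toFinite _)
  rw [Set.ncard_coe_finset] at h1
  have h2 : #E ≤ #S.Q * #S.Q + #S.A + #S.A + #(S.Q ∪ S.A)ᶜ := by
    refine (card_union_le _ _).trans (add_le_add ?_ card_image_le)
    refine (card_union_le _ _).trans (add_le_add ?_ card_image_le)
    refine (card_union_le _ _).trans (add_le_add ?_ card_image_le)
    rw [← card_product]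
    exact card_image_le
  have h3 := card_compl_add_card (S.Q ∪ S.A)
  rw [card_union_of_disjoint S.disj] at h3
  have h4 : #S.Q * #S.Q ≤ m ^ 2 := by
    have := S.card_Q
    rw [pow_two]
    exact Nat.mul_le_mul (by omega) (by omega)
  omega

theorem sat_le [Fintype V] (hm : 5 ≤ m) :
    sat G (SimpleGraph.cycleGraph m) ≤ Fintype.card V + #S.A + m ^ 2 := by
  refine le_trans ?_ S.ncard_edgeSet_le
  exact Nat.sInf_le ⟨S.graph, S.isSaturatedIn hm, rfl⟩

end HubSystem

/-! ### Hub systems in graphs with good expansion -/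

section Assignment

variable {V : Type*} [DecidableEq V] {G : SimpleGraph V}

/-- Sets between which there is always an edge produce a vertex of large degree. -/
theorem exists_large_neighborhood [DecidableRel G.Adj] {t M : ℕ}
    (hG : ∀ A B : Finset V, Disjoint A B → t ≤ #A → t ≤ #B → ∃ a ∈ A, ∃ b ∈ B, G.Adj a b)
    {U R : Finset V} (hUR : Disjoint U R) (hU : t ≤ #U) (hR : t * M + t ≤ #R) :
    ∃ a ∈ U, M ≤ #(R.filter fun v => G.Adj a v) := by
  obtain ⟨U', hU'U, hU'⟩ := exists_subset_card_eq hU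
  by_contra hcon
  push Not at hcon
  set Z := R.filter fun v => ∀ a ∈ U', ¬ G.Adj a v with hZ
  have hsub : R ⊆ Z ∪ U'.biUnion fun a => R.filter fun v => G.Adj a v := by
    intro v hv
    by_cases h : ∃ a ∈ U', G.Adj a v
    · obtain ⟨a, ha, hav⟩ := h
      exact mem_union_right _ (mem_biUnion.2 ⟨a, ha, mem_filter.2 ⟨hv, hav⟩⟩)
    · push Not at h
      exact mem_union_left _ (mem_filter.2 ⟨hv, h⟩)
  have h1 : #(U'.biUnion fun a => R.filter fun v => G.Adj a v) ≤ t * M := by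
    rw [← hU']
    exact card_biUnion_le_card_mul _ _ _ fun a ha => (hcon a (hU'U ha)).le
  have h2 := (card_le_card hsub).trans (card_union_le _ _)
  obtain ⟨a, ha, b, hb, hab⟩ := hG U' Z
    (disjoint_left.2 fun x hx hxZ =>
      disjoint_left.1 hUR (hU'U hx) (mem_filter.1 hxZ).1) hU'.ge (by omega)
  exact (mem_filter.1 hb).2 a ha hab

/-- The greedy assignment of independent `k`-sets to hubs: all but `r₀` vertices of `R` are
assigned to adjacent hubs in `U`, at most one `k`-set to each hub. -/
theorem exists_assignment [DecidableRel G.Adj] {t M k r₀ : ℕ}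
    (hG : ∀ A B : Finset V, Disjoint A B → t ≤ #A → t ≤ #B → ∃ a ∈ A, ∃ b ∈ B, G.Adj a b)
    (hI : ∀ W : Finset V, M ≤ #W → ∃ S ⊆ W, #S = k ∧ ∀ a ∈ S, ∀ b ∈ S, ¬ G.Adj a b)
    (hr₀ : t * M + t ≤ r₀) : ∀ (i : ℕ) (R U : Finset V), Disjoint U R → #R ≤ i * k + r₀ →
      i + t ≤ #U → ∃ R' ⊆ R, #R' ≤ r₀ ∧ ∃ f : V → V,
        (∀ v ∈ R, v ∉ R' → f v ∈ U ∧ G.Adj v (f v)) ∧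
        ∀ u ∈ R, u ∉ R' → ∀ v ∈ R, v ∉ R' → f u = f v → ¬ G.Adj u v := by
  intro i
  induction i with
  | zero =>
    intro R U _ hR _
    exact ⟨R, le_rfl, by omega, id, fun v hv hv' => absurd hv hv', fun u hu hu' => absurd hu hu'⟩
  | succ i ih =>
    intro R U hUR hR hU
    rcases Nat.lt_or_ge r₀ #R with hlt | hle
    swap
    · exact ⟨R, le_rfl, hle, id, fun v hv hv' => absurd hv hv', fun u hu hu' => absurd hu hu'⟩
    obtain ⟨a, haU, haM⟩ := exists_large_neighborhood (M := M) hG hUR (by omega) (by omega)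
    obtain ⟨S, hSW, hSk, hSI⟩ := hI _ haM
    have hSR : S ⊆ R := hSW.trans (filter_subset _ _)
    obtain ⟨R', hR'R, hR'c, f, hf1, hf2⟩ := ih (R \ S) (U.erase a)
      (disjoint_of_subset_left (erase_subset _ _) (disjoint_of_subset_right sdiff_subset hUR))
      (by rw [card_sdiff_of_subset hSR, hSk, Nat.sub_le_iff_le_add]; linarith)
      (by rw [card_erase_of_mem haU]; omega)
    refine ⟨R', hR'R.trans sdiff_subset, hR'c, fun v => if v ∈ S then a else f v, ?_, ?_⟩
    · intro v hv hv'
      by_cases hvS : v ∈ S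
      · simp only [hvS, if_true]
        exact ⟨haU, ((mem_filter.1 (hSW hvS)).2).symm⟩
      · simp only [hvS, if_false]
        obtain ⟨h1, h2⟩ := hf1 v (Finset.mem_sdiff.2 ⟨hv, hvS⟩) hv'
        exact ⟨mem_of_mem_erase h1, h2⟩
    · intro u hu hu' v hv hv' he
      by_cases huS : u ∈ S <;> by_cases hvS : v ∈ S <;>
        simp only [huS, hvS, if_true, if_false] at he
      · exact hSI u huS v hvS
      · exact absurd he.symm (ne_of_mem_erase (hf1 v (Finset.mem_sdiff.2 ⟨hv, hvS⟩) hv').1)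
      · exact absurd he (ne_of_mem_erase (hf1 u (Finset.mem_sdiff.2 ⟨hu, huS⟩) hu').1)
      · exact hf2 u (Finset.mem_sdiff.2 ⟨hu, huS⟩) hu' v (Finset.mem_sdiff.2 ⟨hv, hvS⟩) hv' he

/-- Vertices with enough neighbours in `B` can be given distinct neighbours there. -/
theorem exists_injective_assignment [DecidableRel G.Adj] {B : Finset V} {r : ℕ} (R : Finset V)
    (hR : #R ≤ r) (hB : ∀ v ∈ R, r ≤ #(B.filter fun w => G.Adj v w)) :
    ∃ g : V → V, (∀ v ∈ R, g v ∈ B ∧ G.Adj v (g v)) ∧ Set.InjOn g R := by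
  induction R using Finset.induction_on with
  | empty => exact ⟨id, by simp, by simp⟩
  | insert v R hv ih =>
    rw [card_insert_of_notMem hv] at hR
    obtain ⟨g, hg1, hg2⟩ := ih (by omega) fun w hw => hB w (mem_insert_of_mem hw)
    obtain ⟨w, hw, hwg⟩ : ∃ w ∈ B.filter (fun w => G.Adj v w), w ∉ R.image g := by
      refine exists_mem_notMem_of_card_lt_card ?_
      have := hB v (mem_insert_self _ _)
      have : #(R.image g) ≤ #R := card_image_le
      omega
    have hne : ∀ x ∈ R, x ≠ v := fun x hx h => hv (h ▸ hx)
    refine ⟨fun x => if x = v then w else g x, ?_, ?_⟩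
    · intro x hx
      by_cases hxv : x = v
      · simp only [hxv, if_true]
        exact mem_filter.1 hw
      · simp only [hxv, if_false]
        exact hg1 x ((mem_insert.1 hx).resolve_left hxv)
    · intro x hx y hy he
      rw [mem_coe, mem_insert] at hx hy
      by_cases hxv : x = v <;> by_cases hyv : y = v <;>
        simp only [hxv, hyv, if_true, if_false] at he
      · rw [hxv, hyv]
      · exact absurd (mem_image.2 ⟨y, hy.resolve_left hyv, he.symm⟩) hwg
      · exact absurd (mem_image.2 ⟨x, hx.resolve_left hxv, he⟩) hwg
      · exact hg2 (hx.resolve_left hxv) (hy.resolve_left hyv) he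

/-- Common neighbours extend cliques greedily. -/
theorem exists_clique {m : ℕ} [Fintype V]
    (hC : ∀ T : Finset V, #T ≤ m → ∃ w, w ∉ T ∧ ∀ v ∈ T, G.Adj v w) (i : ℕ) (hi : i ≤ m + 1) :
    ∃ Q : Finset V, #Q = i ∧ ∀ u ∈ Q, ∀ v ∈ Q, u ≠ v → G.Adj u v := by
  induction i with
  | zero => exact ⟨∅, rfl, by simp⟩
  | succ i ih =>
    obtain ⟨Q, hQ, hadj⟩ := ih (by omega)
    obtain ⟨w, hw, hwQ⟩ := hC Q (by omega)
    refine ⟨insert w Q, by rw [card_insert_of_notMem hw, hQ], fun u hu v hv huv => ?_⟩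
    rw [mem_insert] at hu hv
    rcases hu with rfl | hu <;> rcases hv with rfl | hv
    · exact absurd rfl huv
    · exact (hwQ v hv).symm
    · exact hwQ u hu
    · exact hadj u hu v hv huv

/-- The upper bound on the saturation number, before the asymptotics: `N` hubs receive independent
`k`-sets, and the common neighbours of `c₁` and `c₂` in `W₀` are hubs for single vertices. -/
theorem sat_le_of_expansion [Fintype V] [DecidableRel G.Adj] {m t M k r₀ i N : ℕ} (hm : 5 ≤ m)
    {W₀ : Finset V}
    (hG : ∀ A B : Finset V, Disjoint A B → t ≤ #A → t ≤ #B → ∃ a ∈ A, ∃ b ∈ B, G.Adj a b)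
    (hI : ∀ W : Finset V, M ≤ #W → ∃ S ⊆ W, #S = k ∧ ∀ a ∈ S, ∀ b ∈ S, ¬ G.Adj a b)
    (hr₀ : t * M + t ≤ r₀) (hcard : Fintype.card V ≤ i * k + r₀) (hN : i + t ≤ N) (hN2 : 2 ≤ N)
    (hC : ∀ T : Finset V, #T ≤ m →
      N + #W₀ + m ≤ #((univ \ T).filter fun w => ∀ v ∈ T, G.Adj v w))
    (hC₀ : ∀ T : Finset V, #T ≤ m →
      r₀ + m ≤ #((W₀ \ T).filter fun w => ∀ v ∈ T, G.Adj v w)) :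
    sat G (SimpleGraph.cycleGraph m) ≤ Fintype.card V + (N + #W₀) + m ^ 2 := by
  obtain ⟨Q, hQ, hQadj⟩ := exists_clique (G := G) (m := m) (fun T hT => by
    obtain ⟨w, hw⟩ := card_pos.1 (lt_of_lt_of_le (by omega) (hC T hT))
    rw [mem_filter, Finset.mem_sdiff] at hw
    exact ⟨w, hw.1.2, hw.2⟩) (m - 2) (by omega)
  obtain ⟨c₁, hc₁, c₂, hc₂, hne⟩ := one_lt_card.1 (show 1 < #Q by omega)
  set C := (univ \ {c₁, c₂}).filter fun w => ∀ v ∈ ({c₁, c₂} : Finset V), G.Adj v w with hCdef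
  have hCadj : ∀ w ∈ C, G.Adj c₁ w ∧ G.Adj c₂ w := fun w hw =>
    ⟨(mem_filter.1 hw).2 c₁ (by simp), (mem_filter.1 hw).2 c₂ (by simp)⟩
  have hCcard : N + #W₀ + m ≤ #C := hC _ (card_le_two.trans (by omega))
  -- `A₁` are the hubs for independent `k`-sets, `B` those for the single vertices left over
  set B := (C ∩ W₀) \ Q with hBdef
  obtain ⟨A₁, hA₁sub, hA₁⟩ := exists_subset_card_eq (s := C \ (Q ∪ W₀)) (n := N) (by
    have h1 := le_card_sdiff (Q ∪ W₀) C
    have h2 := card_union_le Q W₀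
    omega)
  have hA₁' : ∀ a ∈ A₁, a ∈ C ∧ a ∉ Q ∧ a ∉ W₀ := fun a ha => by
    have := hA₁sub ha
    simp only [Finset.mem_sdiff, mem_union, not_or] at this
    exact this
  have hB' : ∀ b ∈ B, b ∈ C ∧ b ∈ W₀ ∧ b ∉ Q := fun b hb => by
    simp only [hBdef, Finset.mem_sdiff, mem_inter] at hb
    tauto
  set A := A₁ ∪ B with hA
  have hAC : ∀ a ∈ A, a ∈ C ∧ a ∉ Q := fun a ha => by
    rcases mem_union.1 ha with h | h
    · exact ⟨(hA₁' a h).1, (hA₁' a h).2.1⟩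
    · exact ⟨(hB' a h).1, (hB' a h).2.2⟩
  set R := (Q ∪ A)ᶜ with hR
  have hmemR : ∀ v, v ∉ Q → v ∉ A → v ∈ R := fun v h1 h2 => by simp [hR, h1, h2]
  obtain ⟨R', hR'R, hR'c, f, hf1, hf2⟩ := exists_assignment (k := k) (r₀ := r₀) hG hI hr₀ i R A₁
    (disjoint_left.2 fun x hx hxR => by simp [hR, hA, hx] at hxR)
    ((card_le_univ _).trans hcard) (by omega)
  obtain ⟨g, hg1, hg2⟩ := exists_injective_assignment (G := G) (B := B) (r := r₀) R' hR'c (by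
    intro v hv
    have hvR := hR'R hv
    simp only [hR, mem_compl, mem_union, not_or] at hvR
    have h1 := hC₀ {v, c₁, c₂} (card_le_three.trans (by omega))
    have h2 : (W₀ \ {v, c₁, c₂}).filter (fun w => ∀ x ∈ ({v, c₁, c₂} : Finset V), G.Adj x w) \ Q ⊆
        B.filter fun w => G.Adj v w := by
      intro w hw
      simp only [Finset.mem_sdiff, mem_filter, mem_insert, mem_singleton, not_or, forall_eq_or_imp,
        forall_eq] at hw
      simp only [hBdef, hCdef, Finset.mem_sdiff, mem_filter, mem_inter, mem_univ, mem_insert,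
        mem_singleton, not_or, forall_eq_or_imp, forall_eq]
      tauto
    have h3 := card_le_card h2
    have h4 := le_card_sdiff Q
      ((W₀ \ {v, c₁, c₂}).filter (fun w => ∀ x ∈ ({v, c₁, c₂} : Finset V), G.Adj x w))
    omega)
  have hdisj : ∀ x ∈ A₁, x ∉ B := fun x hx hxB => (hA₁' x hx).2.2 (hB' x hxB).2.1
  let S : HubSystem G m :=
    { Q := Q
      A := A
      c₁ := c₁
      c₂ := c₂
      f := fun v => if v ∈ R' then g v else f v
      adj_of_mem := hQadj
      card_Q := by omega
      mem₁ := hc₁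
      mem₂ := hc₂
      ne := hne
      disj := disjoint_right.2 fun a ha => (hAC a ha).2
      adj₁ := fun a ha => (hCadj a (hAC a ha).1).1.symm
      adj₂ := fun a ha => (hCadj a (hAC a ha).1).2.symm
      two_le := by
        have : #A₁ ≤ #A := card_le_card subset_union_left
        omega
      f_mem := fun v h1 h2 => by
        by_cases hv : v ∈ R'
        · simp only [hv, if_true]
          exact mem_union_right _ (hg1 v hv).1
        · simp only [hv, if_false]
          exact mem_union_left _ (hf1 v (hmemR v h1 h2) hv).1
      adj_f := fun v h1 h2 => by
        by_cases hv : v ∈ R'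
        · simp only [hv, if_true]
          exact (hg1 v hv).2
        · simp only [hv, if_false]
          exact (hf1 v (hmemR v h1 h2) hv).2
      indep := fun u v hu hu' hv hv' he => by
        have huR := hmemR u hu hu'
        have hvR := hmemR v hv hv'
        by_cases h1 : u ∈ R' <;> by_cases h2 : v ∈ R' <;>
          simp only [h1, h2, if_true, if_false] at he
        · rw [hg2 h1 h2 he]
          exact G.loopless.irrefl v
        · exact absurd (hg1 u h1).1 (he ▸ hdisj _ (hf1 v hvR h2).1)
        · exact absurd (hg1 v h2).1 (he ▸ hdisj _ (hf1 u huR h1).1)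
        · exact hf2 u huR h1 v hvR h2 he }
  refine (S.sat_le hm).trans ?_
  have h1 : #S.A ≤ #A₁ + #B := card_union_le _ _
  have h2 : #B ≤ #W₀ := card_le_card (sdiff_subset.trans inter_subset_right)
  omega

end Assignment

/-! ### Properties that hold with high probability -/

section WhpTools

variable {p : unitInterval} {Q Q' : ∀ n : ℕ, SimpleGraph (Fin n) → Prop}

/-- The probability that `Q` fails in `G(n, p)`. -/
noncomputable def failure (p : unitInterval) (Q : ∀ n : ℕ, SimpleGraph (Fin n) → Prop)
    (n : ℕ) : ℝ :=
  (SimpleGraph.binomialRandom (Fin n) p).real {G | ¬ Q n G}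

theorem failure_nonneg (n : ℕ) : 0 ≤ failure p Q n := measureReal_nonneg

theorem whp_iff : Whp p Q ↔ Tendsto (failure p Q) atTop (𝓝 0) := by
  have key : ∀ n, SimpleGraph.binomialRandom (Fin n) p {G | Q n G} =
      ENNReal.ofReal (1 - failure p Q n) := by
    intro n
    have hm : MeasurableSet {G : SimpleGraph (Fin n) | Q n G} := (Set.toFinite _).measurableSet
    have h1 : failure p Q n = 1 - (SimpleGraph.binomialRandom (Fin n) p).real {G | Q n G} := by
      rw [failure, ← probReal_compl_eq_one_sub hm]
      rfl
    rw [h1, sub_sub_cancel, ofReal_measureReal]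
  have hle : ∀ n, failure p Q n ≤ 1 := fun n => measureReal_le_one
  unfold Whp
  simp only [key]
  constructor
  · intro h
    have h2 := (ENNReal.tendsto_toReal ENNReal.one_ne_top).comp h
    have h3 : Tendsto (fun n => 1 - (1 - failure p Q n)) atTop (𝓝 (1 - 1)) := by
      refine Tendsto.const_sub 1 ?_
      refine h2.congr fun n => ?_
      exact ENNReal.toReal_ofReal (by linarith [hle n])
    simpa using h3
  · intro h
    have h2 : Tendsto (fun n => 1 - failure p Q n) atTop (𝓝 (1 - 0)) := h.const_sub 1
    have := ENNReal.tendsto_ofReal h2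
    simpa using this

theorem whp_of_le {g : ℕ → ℝ} (hg : Tendsto g atTop (𝓝 0))
    (h : ∀ᶠ n in atTop, failure p Q n ≤ g n) : Whp p Q :=
  whp_iff.2 (tendsto_of_tendsto_of_tendsto_of_le_of_le' tendsto_const_nhds hg
    (Eventually.of_forall failure_nonneg) h)

theorem Whp.mono (h : Whp p Q) (h' : ∀ᶠ n in atTop, ∀ G, Q n G → Q' n G) : Whp p Q' := by
  refine whp_of_le (whp_iff.1 h) ?_
  filter_upwards [h'] with n hn
  exact measureReal_mono (fun G hG hQ => hG (hn G hQ))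

theorem Whp.and (h : Whp p Q) (h' : Whp p Q') : Whp p (fun n G => Q n G ∧ Q' n G) := by
  have hs := (whp_iff.1 h).add (whp_iff.1 h')
  rw [add_zero] at hs
  refine whp_of_le hs (Eventually.of_forall fun n => ?_)
  refine le_trans (measureReal_mono ?_) (measureReal_union_le _ _)
  intro G hG
  by_cases hQ : Q n G
  · exact Or.inr fun hQ' => hG ⟨hQ, hQ'⟩
  · exact Or.inl hQ

/-- A union bound with equally bounded terms. -/
theorem failure_le_card_mul {κ : Type*} {n : ℕ} (I : Finset κ) {E : κ → SimpleGraph (Fin n) → Prop}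
    {c : ℝ} (hcov : ∀ G, ¬ Q n G → ∃ i ∈ I, E i G)
    (hE : ∀ i ∈ I, (SimpleGraph.binomialRandom (Fin n) p).real {G | E i G} ≤ c) :
    failure p Q n ≤ #I * c := by
  calc failure p Q n ≤ (SimpleGraph.binomialRandom (Fin n) p).real (⋃ i ∈ I, {G | E i G}) := by
        refine measureReal_mono (fun G hG => ?_) (measure_ne_top _ _)
        obtain ⟨i, hi, h⟩ := hcov G hG
        exact Set.mem_biUnion hi h
    _ ≤ ∑ i ∈ I, (SimpleGraph.binomialRandom (Fin n) p).real {G | E i G} :=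
        measureReal_biUnion_finset_le _ _
    _ ≤ #I * c := by
        rw [← nsmul_eq_mul]
        exact sum_le_card_nsmul _ _ _ hE

/-- If a property with a parameter `ε` holds with high probability for every fixed `ε > 0`, it
holds with high probability along some sequence of parameters that tends to zero. -/
theorem exists_tendsto_zero_whp {Q : ℝ → ∀ n : ℕ, SimpleGraph (Fin n) → Prop}
    (h : ∀ ε > 0, Whp p (Q ε)) :
    ∃ δ : ℕ → ℝ, Tendsto δ atTop (𝓝 0) ∧ Whp p (fun n G => Q (δ n) n G) := by
  have hex : ∀ k : ℕ, ∃ N, ∀ n ≥ N, failure p (Q (1 / ((k : ℝ) + 1))) n < 1 / ((k : ℝ) + 1) := by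
    intro k
    have := (whp_iff.1 (h (1 / ((k : ℝ) + 1)) (by positivity))).eventually
      (gt_mem_nhds (show (0 : ℝ) < 1 / ((k : ℝ) + 1) by positivity))
    exact eventually_atTop.1 this
  choose N hN using hex
  set κ : ℕ → ℕ := fun n => Nat.findGreatest (fun k => N k ≤ n) n with hκ
  have hκtop : Tendsto κ atTop atTop := by
    refine tendsto_atTop.2 fun K => eventually_atTop.2 ⟨max K (N K), fun n hn => ?_⟩
    exact Nat.le_findGreatest (le_of_max_le_left hn) (le_of_max_le_right hn)
  have hδ : Tendsto (fun n => 1 / ((κ n : ℝ) + 1)) atTop (𝓝 0) :=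
    tendsto_one_div_add_atTop_nhds_zero_nat.comp hκtop
  refine ⟨_, hδ, whp_of_le hδ ?_⟩
  filter_upwards [eventually_ge_atTop (N 0)] with n hn
  have hspec : N (κ n) ≤ n := Nat.findGreatest_spec (P := fun k => N k ≤ n) (Nat.zero_le n) hn
  exact (hN (κ n) n hspec).le

end WhpTools

/-! ### Growth of the logarithm to base `1 / (1 - p)` -/

section Growth

/-- The logarithm of `n` to base `1 / (1 - p)`. -/
noncomputable def logBase (p : ℝ) (n : ℕ) : ℝ := Real.logb (1 / (1 - p)) n

variable {p : ℝ}

theorem one_lt_base (h0 : 0 < p) (h1 : p < 1) : 1 < 1 / (1 - p) := by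
  rw [lt_div_iff₀ (by linarith)]; linarith

theorem tendsto_logBase (h0 : 0 < p) (h1 : p < 1) : Tendsto (logBase p) atTop atTop :=
  (Real.tendsto_logb_atTop (one_lt_base h0 h1)).comp tendsto_natCast_atTop_atTop

theorem eventually_logBase_ge (h0 : 0 < p) (h1 : p < 1) (K : ℝ) :
    ∀ᶠ n in atTop, K ≤ logBase p n :=
  (tendsto_logBase h0 h1).eventually_ge_atTop K

theorem eventually_mul_logBase_pow_le (h0 : 0 < p) (h1 : p < 1) (C : ℝ) (a : ℕ) {b : ℝ}
    (hb : 0 < b) : ∀ᶠ n : ℕ in atTop, C * logBase p n ^ a ≤ (n : ℝ) ^ b := by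
  set c := Real.log (1 / (1 - p)) with hc
  have hcpos : 0 < c := Real.log_pos (one_lt_base h0 h1)
  have h2 := (isLittleO_log_rpow_rpow_atTop (a : ℝ) hb).comp_tendsto
    (tendsto_natCast_atTop_atTop (R := ℝ))
  have h3 := h2.def (show 0 < c ^ a / (|C| + 1) by positivity)
  filter_upwards [h3, eventually_ge_atTop 1] with n hn hn1
  have hn1' : (1 : ℝ) ≤ n := by exact_mod_cast hn1
  have hlog : 0 ≤ Real.log n := Real.log_nonneg hn1'
  simp only [Function.comp_apply, Real.rpow_natCast, Real.norm_eq_abs] at hn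
  rw [abs_of_nonneg (show 0 ≤ Real.log n ^ a by positivity),
    abs_of_nonneg (show (0 : ℝ) ≤ (n : ℝ) ^ b by positivity)] at hn
  have hL : logBase p n ^ a = Real.log n ^ a / c ^ a := by
    rw [logBase, Real.logb, div_pow]
  have hLn : 0 ≤ Real.log n ^ a / c ^ a := by positivity
  rw [hL]
  calc C * (Real.log n ^ a / c ^ a) ≤ (|C| + 1) * (Real.log n ^ a / c ^ a) :=
        mul_le_mul_of_nonneg_right ((le_abs_self C).trans (by linarith)) hLn
    _ ≤ (|C| + 1) * (c ^ a / (|C| + 1) * (n : ℝ) ^ b / c ^ a) := by gcongr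
    _ = (n : ℝ) ^ b := by field_simp

theorem eventually_mul_logBase_pow_le_self (h0 : 0 < p) (h1 : p < 1) (C : ℝ) (a : ℕ) :
    ∀ᶠ n : ℕ in atTop, C * logBase p n ^ a ≤ n := by
  simpa using eventually_mul_logBase_pow_le h0 h1 C a one_pos

theorem rpow_mul_logBase (h0 : 0 < p) (h1 : p < 1) {n : ℕ} (hn : 0 < n) (x : ℝ) :
    (1 - p) ^ (x * logBase p n) = (n : ℝ) ^ (-x) := by
  have hq : 0 < 1 - p := by linarith
  have hb := one_lt_base h0 h1
  have h2 : (1 / (1 - p)) ^ (logBase p n) = (n : ℝ) :=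
    Real.rpow_logb (by positivity) hb.ne' (by exact_mod_cast hn)
  have h3 : (1 - p) ^ (logBase p n) = (n : ℝ)⁻¹ := by
    rw [← h2, one_div, Real.inv_rpow hq.le, inv_inv]
  rw [mul_comm, Real.rpow_mul hq.le, h3, Real.inv_rpow (by positivity), Real.rpow_neg (by positivity)]

theorem pow_le_of_le_mul_logBase (h0 : 0 < p) (h1 : p < 1) {n : ℕ} (hn : 0 < n) {x : ℝ} {s : ℕ}
    (hs : x * logBase p n ≤ s) : (1 - p) ^ s ≤ (n : ℝ) ^ (-x) := by
  rw [← rpow_mul_logBase h0 h1 hn, ← Real.rpow_natCast]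
  exact Real.rpow_le_rpow_of_exponent_ge (by linarith) (by linarith) hs

theorem inv_pow_le_of_mul_logBase_le (h0 : 0 < p) (h1 : p < 1) {n : ℕ} (hn : 0 < n) {x : ℝ}
    {s : ℕ} (hs : s ≤ x * logBase p n) : ((1 - p) ^ s)⁻¹ ≤ (n : ℝ) ^ x := by
  have hq : 0 < 1 - p := by linarith
  have h2 : (n : ℝ) ^ (-x) ≤ (1 - p) ^ s := by
    rw [← rpow_mul_logBase h0 h1 hn, ← Real.rpow_natCast]
    exact Real.rpow_le_rpow_of_exponent_ge hq (by linarith) hs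
  have hn' : (0 : ℝ) < n := by exact_mod_cast hn
  rw [inv_le_comm₀ (by positivity) (by positivity), ← Real.rpow_neg hn'.le]
  exact h2

theorem card_powersetCard_univ_le (n s : ℕ) :
    (#((univ : Finset (Fin n)).powersetCard s) : ℝ) ≤ (n : ℝ) ^ s := by
  rw [card_powersetCard, card_univ, Fintype.card_fin]
  exact_mod_cast Nat.choose_le_pow n s

theorem card_filter_card_le {n : ℕ} (hn : 1 ≤ n) (m : ℕ) :
    (#((univ : Finset (Finset (Fin n))).filter fun T => #T ≤ m) : ℝ) ≤
      ((m : ℝ) + 1) * (n : ℝ) ^ m := by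
  have hsub : ((univ : Finset (Finset (Fin n))).filter fun T => #T ≤ m) ⊆
      (range (m + 1)).biUnion fun i => univ.powersetCard i := by
    intro T hT
    exact mem_biUnion.2 ⟨#T, mem_range.2 (Nat.lt_succ_of_le (mem_filter.1 hT).2),
      mem_powersetCard.2 ⟨subset_univ _, rfl⟩⟩
  have h2 := card_biUnion_le_card_mul (range (m + 1))
    (fun i => (univ : Finset (Fin n)).powersetCard i) (n ^ m) fun i hi => by
      rw [card_powersetCard, card_univ, Fintype.card_fin]
      exact (Nat.choose_le_pow n i).trans
        (Nat.pow_le_pow_right hn (Nat.lt_succ_iff.1 (mem_range.1 hi)))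
  rw [card_range] at h2
  exact_mod_cast (card_le_card hsub).trans h2

end Growth

/-! ### Typical properties of the binomial random graph -/

section WhpProperties

variable {p : unitInterval}

/-- There is an edge between any two disjoint sets of logarithmic size. -/
theorem whp_exists_edge_between (h0 : 0 < (p : ℝ)) (h1 : (p : ℝ) < 1) :
    Whp p fun n G => ∀ A B : Finset (Fin n), Disjoint A B → ⌈3 * logBase p n⌉₊ ≤ #A →
      ⌈3 * logBase p n⌉₊ ≤ #B → ∃ a ∈ A, ∃ b ∈ B, G.Adj a b := by
  have hg : Tendsto (fun n : ℕ => ((n : ℝ))⁻¹) atTop (𝓝 0) := tendsto_inv_atTop_nhds_zero_nat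
  refine whp_of_le hg ?_
  filter_upwards [eventually_ge_atTop 1, eventually_logBase_ge h0 h1 1] with n hn hL
  set t := ⌈3 * logBase p n⌉₊ with ht
  have hn' : (1 : ℝ) ≤ n := by exact_mod_cast hn
  have hq : 0 < 1 - (p : ℝ) := by linarith
  have ht1 : 1 ≤ t := by
    rw [ht, Nat.one_le_ceil_iff]; linarith
  set I := ((univ : Finset (Fin n)).powersetCard t ×ˢ univ.powersetCard t).filter
    fun x => Disjoint x.1 x.2 with hI
  have hfail := failure_le_card_mul (p := p) (n := n)
    (Q := fun n G => ∀ A B : Finset (Fin n), Disjoint A B → ⌈3 * logBase p n⌉₊ ≤ #A →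
      ⌈3 * logBase p n⌉₊ ≤ #B → ∃ a ∈ A, ∃ b ∈ B, G.Adj a b) I
    (E := fun x G => ∀ a ∈ x.1, ∀ b ∈ x.2, ¬ G.Adj a b) (c := (1 - (p : ℝ)) ^ (t * t)) (by
      intro G hG
      push Not at hG
      obtain ⟨A, B, hAB, hA, hB, hno⟩ := hG
      obtain ⟨A', hA', hA'c⟩ := exists_subset_card_eq hA
      obtain ⟨B', hB', hB'c⟩ := exists_subset_card_eq hB
      refine ⟨(A', B'), mem_filter.2 ⟨mem_product.2 ⟨?_, ?_⟩, ?_⟩, fun a ha b hb =>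
        hno a (hA' ha) b (hB' hb)⟩
      · exact mem_powersetCard.2 ⟨subset_univ _, hA'c⟩
      · exact mem_powersetCard.2 ⟨subset_univ _, hB'c⟩
      · exact disjoint_of_subset_left hA' (disjoint_of_subset_right hB' hAB)) (by
      rintro ⟨A, B⟩ hx
      obtain ⟨hx, hd⟩ := mem_filter.1 hx
      obtain ⟨hA, hB⟩ := mem_product.1 hx
      have := prob_no_edge_between p hd
      rw [(mem_powersetCard.1 hA).2, (mem_powersetCard.1 hB).2] at this
      exact this.le)
  refine hfail.trans ?_
  have hIc : (#I : ℝ) ≤ (n : ℝ) ^ t * (n : ℝ) ^ t := by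
    calc (#I : ℝ) ≤ #((univ : Finset (Fin n)).powersetCard t ×ˢ univ.powersetCard t) := by
          exact_mod_cast card_filter_le _ _
      _ ≤ _ := by
          rw [card_product, Nat.cast_mul]
          have := card_powersetCard_univ_le n t
          gcongr
  -- the constant `3` beats the `n ^ (2 * t)` pairs of sets and leaves a factor `n ^ (-t)`
  have hqt : (1 - (p : ℝ)) ^ t ≤ (n : ℝ) ^ (-3 : ℝ) :=
    pow_le_of_le_mul_logBase h0 h1 hn (Nat.le_ceil _)
  calc (#I : ℝ) * (1 - (p : ℝ)) ^ (t * t)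
      ≤ (n : ℝ) ^ t * (n : ℝ) ^ t * ((n : ℝ) ^ (-3 : ℝ)) ^ t := by
        rw [pow_mul]; gcongr
    _ = ((n : ℝ)⁻¹) ^ t := by
        rw [← mul_pow, ← mul_pow]
        congr 1
        rw [show (-3 : ℝ) = -((3 : ℕ) : ℝ) by norm_num, Real.rpow_neg (by positivity),
          Real.rpow_natCast]
        field_simp
    _ ≤ (n : ℝ)⁻¹ := pow_le_of_le_one (by positivity) (inv_le_one_of_one_le₀ hn') (by omega)

/-- The independence number of `G(n, p)` is at most `(2 + ε) log_{1/(1-p)} n`. -/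
theorem whp_independent_card_le (h0 : 0 < (p : ℝ)) (h1 : (p : ℝ) < 1) {ε : ℝ} (hε : 0 < ε) :
    Whp p fun n G => ∀ S : Finset (Fin n), (∀ a ∈ S, ∀ b ∈ S, ¬ G.Adj a b) →
      #S ≤ ⌊(2 + ε) * logBase p n⌋₊ := by
  set q : ℝ := 1 - p with hqdef
  have hq : 0 < q := by linarith
  have hq1 : q < 1 := by linarith
  have hg0 : Tendsto (fun n : ℕ => q⁻¹ * (n : ℝ) ^ (-ε)) atTop (𝓝 0) := by
    have := ((tendsto_rpow_neg_atTop hε).comp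
      (tendsto_natCast_atTop_atTop (R := ℝ))).const_mul q⁻¹
    simpa using this
  have hg : Tendsto (fun n : ℕ => √(q⁻¹ * (n : ℝ) ^ (-ε))) atTop (𝓝 0) := by
    simpa using hg0.sqrt
  refine whp_of_le hg ?_
  filter_upwards [eventually_ge_atTop 1, eventually_logBase_ge h0 h1 1,
    hg0.eventually (gt_mem_nhds one_pos)] with n hn hL hsmall
  set s := ⌊(2 + ε) * logBase p n⌋₊ with hs
  have hn' : (1 : ℝ) ≤ n := by exact_mod_cast hn
  have hn0 : (0 : ℝ) < n := by linarith
  have hfail := failure_le_card_mul (p := p) (n := n)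
    (Q := fun n G => ∀ S : Finset (Fin n), (∀ a ∈ S, ∀ b ∈ S, ¬ G.Adj a b) →
      #S ≤ ⌊(2 + ε) * logBase p n⌋₊) (univ.powersetCard (s + 1))
    (E := fun S G => ∀ a ∈ S, ∀ b ∈ S, ¬ G.Adj a b) (c := q ^ (s + 1).choose 2) (by
      intro G hG
      push Not at hG
      obtain ⟨S, hS, hc⟩ := hG
      obtain ⟨S', hS', hS'c⟩ := exists_subset_card_eq (show s + 1 ≤ #S from hc)
      exact ⟨S', mem_powersetCard.2 ⟨subset_univ _, hS'c⟩,
        fun a ha b hb => hS a (hS' ha) b (hS' hb)⟩) (by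
      intro S hS
      have := prob_independent p S
      rw [(mem_powersetCard.1 hS).2] at this
      exact this.le)
  refine hfail.trans ((mul_le_mul_of_nonneg_right (card_powersetCard_univ_le n (s + 1))
    (by positivity)).trans (Real.le_sqrt_of_sq_le ?_))
  have hch : (s + 1).choose 2 * 2 = s * (s + 1) := by
    rw [Nat.choose_two_right, Nat.div_mul_cancel (Nat.even_mul_pred_self _).two_dvd,
      Nat.add_sub_cancel, mul_comm]
  have hqs : q ^ s ≤ q⁻¹ * (n : ℝ) ^ (-(2 + ε)) := by
    have h2 : (2 + ε) * logBase p n ≤ ((s + 1 : ℕ) : ℝ) := by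
      push_cast
      exact (Nat.lt_floor_add_one _).le
    have h3 := pow_le_of_le_mul_logBase h0 h1 hn h2
    rw [← hqdef, pow_succ] at h3
    rw [inv_mul_eq_div, le_div_iff₀ hq]
    exact h3
  have he : (n : ℝ) ^ 2 * (n : ℝ) ^ (-(2 + ε)) = (n : ℝ) ^ (-ε) := by
    rw [← Real.rpow_natCast, ← Real.rpow_add hn0]
    congr 1; push_cast; ring
  -- squaring removes the half in the exponent `s * (s + 1) / 2`
  calc ((n : ℝ) ^ (s + 1) * q ^ (s + 1).choose 2) ^ 2
      = ((n : ℝ) ^ 2 * q ^ s) ^ (s + 1) := by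
        rw [mul_pow, ← pow_mul, ← pow_mul, hch, mul_pow, ← pow_mul, ← pow_mul]
        ring
    _ ≤ ((n : ℝ) ^ 2 * (q⁻¹ * (n : ℝ) ^ (-(2 + ε)))) ^ (s + 1) := by gcongr
    _ = (q⁻¹ * (n : ℝ) ^ (-ε)) ^ (s + 1) := by rw [← he]; congr 1; ring
    _ ≤ q⁻¹ * (n : ℝ) ^ (-ε) := pow_le_of_le_one (by positivity) hsmall.le (by omega)

/-- All sets of bounded size have the expected number of common neighbours, up to a constant
factor, in a given set of vertices. -/
theorem whp_common_neighbors (h0 : 0 < (p : ℝ)) (m : ℕ) (W : ∀ n, Finset (Fin n))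
    (hW : ∀ᶠ n : ℕ in atTop, √(n : ℝ) ≤ #(W n)) :
    Whp p fun n G => ∀ T : Finset (Fin n), #T ≤ m →
      ((#(W n) : ℝ) - m) * (p : ℝ) ^ m / 2 ≤ {w | w ∈ W n \ T ∧ ∀ t ∈ T, G.Adj t w}.ncard := by
  classical
  set c : ℝ := (p : ℝ) ^ m / 8 with hc
  have hcpos : 0 < c := by positivity
  have hp1 : (p : ℝ) ≤ 1 := p.2.2
  -- the union bound tends to zero since exponentials beat powers
  have hg : Tendsto (fun n : ℕ => ((m : ℝ) + 1) * (n : ℝ) ^ m *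
      Real.exp (-((√(n : ℝ) - m) * c))) atTop (𝓝 0) := by
    have h2 := tendsto_rpow_mul_exp_neg_mul_atTop_nhds_zero ((2 * m : ℕ) : ℝ) c hcpos
    have h3 : Tendsto (fun n : ℕ => √(n : ℝ)) atTop atTop :=
      Real.tendsto_sqrt_atTop.comp tendsto_natCast_atTop_atTop
    have h4 := (h2.comp h3).const_mul (((m : ℝ) + 1) * Real.exp (m * c))
    rw [mul_zero] at h4
    refine h4.congr fun n => ?_
    simp only [Function.comp_apply, Real.rpow_natCast]
    rw [pow_mul, Real.sq_sqrt (Nat.cast_nonneg n),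
      show -((√(n : ℝ) - m) * c) = m * c + -c * √(n : ℝ) by ring, Real.exp_add]
    ring
  refine whp_of_le hg ?_
  filter_upwards [hW, eventually_ge_atTop ((m + 1) ^ 2)] with n hWn hn
  have hnm : (m : ℝ) + 1 ≤ √(n : ℝ) := by
    refine Real.le_sqrt_of_sq_le ?_
    exact_mod_cast hn
  have hn1 : 1 ≤ n := le_trans (Nat.one_le_pow _ _ (Nat.succ_pos m)) hn
  have hn1' : (1 : ℝ) ≤ n := by exact_mod_cast hn1
  set I := (univ : Finset (Finset (Fin n))).filter fun T => #T ≤ m with hI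
  have hIc : (#I : ℝ) ≤ ((m : ℝ) + 1) * (n : ℝ) ^ m := card_filter_card_le hn1 m
  have hlarge : ∀ T ∈ I, √(n : ℝ) - m ≤ #(W n \ T) := by
    intro T hT
    have h2 : #(W n) ≤ #(W n \ T) + m := by
      have := le_card_sdiff T (W n)
      have := (mem_filter.1 hT).2
      omega
    have h3 : (#(W n) : ℝ) ≤ #(W n \ T) + m := by exact_mod_cast h2
    linarith
  refine (failure_le_card_mul (p := p) (n := n) I
    (E := fun T G => (#((W n \ T).filter fun w => ∀ t ∈ T, G.Adj t w) : ℝ) ≤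
      #(W n \ T) * (p : ℝ) ^ #T / 2)
    (c := Real.exp (-((√(n : ℝ) - m) * c))) ?_ ?_).trans ?_
  · intro G hG
    push Not at hG
    obtain ⟨T, hT, hlt⟩ := hG
    refine ⟨T, mem_filter.2 ⟨mem_univ _, hT⟩, ?_⟩
    have e : {w | w ∈ W n \ T ∧ ∀ t ∈ T, G.Adj t w} =
        ((W n \ T).filter fun w => ∀ t ∈ T, G.Adj t w : Finset (Fin n)) := by
      ext w; simp
    rw [e, Set.ncard_coe_finset] at hlt
    refine hlt.le.trans ?_
    have h2 : (#(W n) : ℝ) - m ≤ #(W n \ T) := by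
      have h3 : #(W n) ≤ #(W n \ T) + m := by
        have := le_card_sdiff T (W n)
        omega
      have h4 : (#(W n) : ℝ) ≤ #(W n \ T) + m := by exact_mod_cast h3
      linarith
    have h3 : (p : ℝ) ^ m ≤ (p : ℝ) ^ #T := pow_le_pow_of_le_one h0.le hp1 hT
    gcongr
  · intro T hT
    have hpos : 0 < (#(W n \ T) : ℝ) := by linarith [hlarge T hT]
    have hne : (W n \ T).Nonempty := card_pos.1 (by exact_mod_cast hpos)
    have hprob := prob_few_common_neighbors p h0 (disjoint_sdiff (s := T) (t := W n)) hne
    refine le_trans (le_of_eq ?_) (hprob.trans (Real.exp_le_exp.2 ?_))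
    · congr! 7
    have h3 : (p : ℝ) ^ m ≤ (p : ℝ) ^ #T := pow_le_pow_of_le_one h0.le hp1 (mem_filter.1 hT).2
    have h4 := hlarge T hT
    have h5 : (√(n : ℝ) - m) * (p : ℝ) ^ m ≤ #(W n \ T) * (p : ℝ) ^ #T := by gcongr
    rw [hc]
    linarith
  · exact mul_le_mul_of_nonneg_right hIc (Real.exp_pos _).le

/-- The second moment of the number of independent `k`-sets with `k ≈ (2 - η) log n` in a set of
`M ≈ n / log⁵ n` vertices. For bounded intersections the overlap probability decides, for larger
ones the gap `η`. -/
theorem eventually_sum_overlap_le {p η : ℝ} (h0 : 0 < p) (h1 : p < 1) (hη : 0 < η) :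
    ∀ᶠ n : ℕ in atTop, ∀ k M : ℕ, (k : ℝ) ≤ (2 - η) * logBase p n + 1 →
      n / logBase p n ^ 5 ≤ M →
      ∑ i ∈ Icc 2 k, ((k : ℝ) ^ 2 / M) ^ i * ((1 - p) ^ i.choose 2)⁻¹ ≤ 1 / (2 * n) := by
  set q := 1 - p with hqdef
  have hq : 0 < q := by linarith
  have hq1 : q < 1 := by linarith
  -- from `i₀` on the gap `η` makes the terms at most `n ^ (-η * i / 4) ≤ n ^ (-2)`
  obtain ⟨i₀, hi₀⟩ := exists_nat_ge (8 / η)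
  set C := (q ^ i₀.choose 2)⁻¹ with hC
  have hCpos : 0 < C := by positivity
  filter_upwards [eventually_ge_atTop 1, eventually_logBase_ge h0 h1 1,
    eventually_mul_logBase_pow_le h0 h1 81 14 (show 0 < η / 2 by positivity),
    eventually_mul_logBase_pow_le_self h0 h1 9 7,
    eventually_mul_logBase_pow_le_self h0 h1 (6 * (81 * C + 1)) 15] with n hn hL hg1 hg2 hg3
  intro k M hk hM
  set L := logBase p n with hLdef
  have hn' : (1 : ℝ) ≤ n := by exact_mod_cast hn
  have hn0 : (0 : ℝ) < n := by linarith
  have hL0 : 0 < L := by linarith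
  have hk3 : (k : ℝ) ≤ 3 * L := by nlinarith
  have hMpos : (0 : ℝ) < M := lt_of_lt_of_le (by positivity) hM
  set x := (k : ℝ) ^ 2 / M with hx
  have hx0 : 0 ≤ x := by positivity
  have hxle : x ≤ 9 * L ^ 7 / n := by
    rw [hx, div_le_div_iff₀ hMpos hn0]
    have h2 : (k : ℝ) ^ 2 ≤ 9 * L ^ 2 := by
      calc (k : ℝ) ^ 2 ≤ (3 * L) ^ 2 := by gcongr
        _ = _ := by ring
    have h3 : (n : ℝ) ≤ M * L ^ 5 := by rwa [div_le_iff₀ (by positivity)] at hM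
    calc (k : ℝ) ^ 2 * n ≤ 9 * L ^ 2 * (M * L ^ 5) := by gcongr
      _ = _ := by ring
  have hx1 : x ≤ 1 := hxle.trans (by rw [div_le_one hn0]; exact hg2)
  have hx2 : x ^ 2 ≤ 81 * L ^ 14 / n ^ 2 := by
    calc x ^ 2 ≤ (9 * L ^ 7 / n) ^ 2 := by gcongr
      _ = _ := by ring
  have hterm : ∀ i ∈ Icc 2 k, x ^ i * (q ^ i.choose 2)⁻¹ ≤ (81 * C + 1) * L ^ 14 / n ^ 2 := by
    intro i hi
    obtain ⟨hi2, hik⟩ := mem_Icc.1 hi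
    have hL14 : 1 ≤ L ^ 14 := one_le_pow₀ hL
    rcases le_total i i₀ with hle | hge
    · have h2 : (q ^ i.choose 2)⁻¹ ≤ C := by
        refine inv_anti₀ (by positivity) (pow_le_pow_of_le_one hq.le hq1.le ?_)
        exact Nat.choose_le_choose 2 hle
      have h3 : x ^ i ≤ x ^ 2 := pow_le_pow_of_le_one hx0 hx1 hi2
      calc x ^ i * (q ^ i.choose 2)⁻¹ ≤ 81 * L ^ 14 / n ^ 2 * C := by
            gcongr; exact h3.trans hx2
        _ = (81 * C) * L ^ 14 / n ^ 2 := by ring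
        _ ≤ _ := by gcongr; linarith
    · have hch : i.choose 2 * 2 = (i - 1) * i := by
        rw [Nat.choose_two_right, Nat.div_mul_cancel (Nat.even_mul_pred_self _).two_dvd, mul_comm]
      have h2 : (q ^ (i - 1))⁻¹ ≤ (n : ℝ) ^ (2 - η) := by
        refine inv_pow_le_of_mul_logBase_le h0 h1 hn ?_
        have : ((i - 1 : ℕ) : ℝ) + 1 ≤ k := by
          have : i - 1 + 1 ≤ k := by omega
          exact_mod_cast this
        linarith
      have h3 : x ^ 2 * (q ^ (i - 1))⁻¹ ≤ (n : ℝ) ^ (-(η / 2)) := by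
        calc x ^ 2 * (q ^ (i - 1))⁻¹ ≤ 81 * L ^ 14 / n ^ 2 * (n : ℝ) ^ (2 - η) := by gcongr
          _ ≤ (n : ℝ) ^ (η / 2) / n ^ 2 * (n : ℝ) ^ (2 - η) := by gcongr
          _ = (n : ℝ) ^ (η / 2 - 2 + (2 - η)) := by
              rw [Real.rpow_add hn0, Real.rpow_sub hn0 (η / 2) 2, Real.rpow_two]
          _ = _ := by congr 1; ring
      have h4 : (x ^ i * (q ^ i.choose 2)⁻¹) ^ 2 ≤ (1 / (n : ℝ) ^ 2) ^ 2 := by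
        calc (x ^ i * (q ^ i.choose 2)⁻¹) ^ 2 = (x ^ 2 * (q ^ (i - 1))⁻¹) ^ i := by
              rw [mul_pow, inv_pow, ← pow_mul, ← pow_mul, hch, mul_pow, inv_pow, ← pow_mul,
                ← pow_mul, mul_comm i 2]
          _ ≤ ((n : ℝ) ^ (-(η / 2))) ^ i := by gcongr
          _ = (n : ℝ) ^ (-(η / 2) * i) := by rw [← Real.rpow_natCast, ← Real.rpow_mul hn0.le]
          _ ≤ (n : ℝ) ^ (-4 : ℝ) := by
              refine Real.rpow_le_rpow_of_exponent_le hn' ?_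
              have h5 : 8 / η ≤ i := hi₀.trans (by exact_mod_cast hge)
              rw [div_le_iff₀ hη] at h5
              linarith
          _ = _ := by
              rw [show (-4 : ℝ) = -((4 : ℕ) : ℝ) by norm_num, Real.rpow_neg hn0.le,
                Real.rpow_natCast]
              field_simp
      have h5 : x ^ i * (q ^ i.choose 2)⁻¹ ≤ 1 / (n : ℝ) ^ 2 :=
        le_of_sq_le_sq h4 (by positivity)
      refine h5.trans ?_
      gcongr
      nlinarith
  calc ∑ i ∈ Icc 2 k, x ^ i * (q ^ i.choose 2)⁻¹
      ≤ #(Icc 2 k) • ((81 * C + 1) * L ^ 14 / n ^ 2) := sum_le_card_nsmul _ _ _ hterm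
    _ ≤ k * ((81 * C + 1) * L ^ 14 / n ^ 2) := by
        rw [nsmul_eq_mul]
        have : (#(Icc 2 k) : ℝ) ≤ k := by
          rw [Nat.card_Icc]
          have : k + 1 - 2 ≤ k := by omega
          exact_mod_cast this
        gcongr
    _ ≤ 3 * L * ((81 * C + 1) * L ^ 14 / n ^ 2) := by gcongr
    _ = (6 * (81 * C + 1) * L ^ 15) / (2 * n ^ 2) := by field_simp; ring
    _ ≤ n / (2 * n ^ 2) := by gcongr
    _ = 1 / (2 * n) := by field_simp

/-- Every set of `n / log⁵ n` vertices contains an independent set of nearly the maximal size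
`2 log_{1/(1-p)} n`. -/
theorem whp_exists_independent_subset (h0 : 0 < (p : ℝ)) (h1 : (p : ℝ) < 1) {η : ℝ} (hη : 0 < η)
    (hη1 : η < 1) :
    Whp p fun n G => ∀ W : Finset (Fin n), ⌈n / logBase p n ^ 5⌉₊ ≤ #W →
      ∃ S ⊆ W, #S = ⌈(2 - η) * logBase p n⌉₊ ∧ ∀ a ∈ S, ∀ b ∈ S, ¬ G.Adj a b := by
  have hg : Tendsto (fun n : ℕ => (2 * Real.exp (-1)) ^ n) atTop (𝓝 0) := by
    refine tendsto_pow_atTop_nhds_zero_of_lt_one (by positivity) ?_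
    rw [Real.exp_neg, ← div_eq_mul_inv, div_lt_one (Real.exp_pos _)]
    exact lt_trans (by norm_num) Real.exp_one_gt_d9
  refine whp_of_le hg ?_
  filter_upwards [eventually_ge_atTop 1, eventually_logBase_ge h0 h1 1,
    eventually_sum_overlap_le h0 h1 hη, eventually_mul_logBase_pow_le_self h0 h1 3 6]
    with n hn hL hsum hg3
  set L := logBase p n with hLdef
  set M := ⌈n / L ^ 5⌉₊ with hM
  set k := ⌈(2 - η) * L⌉₊ with hk
  have hn0 : (0 : ℝ) < n := by exact_mod_cast hn
  have hL0 : 0 < L := by linarith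
  have hk1 : (k : ℝ) ≤ (2 - η) * L + 1 := (Nat.ceil_lt_add_one (by nlinarith)).le
  have hM1 : n / L ^ 5 ≤ (M : ℝ) := Nat.le_ceil _
  have hkM : k ≤ M := by
    have h2 : (k : ℝ) ≤ M := by
      refine le_trans ?_ hM1
      rw [le_div_iff₀ (by positivity)]
      calc (k : ℝ) * L ^ 5 ≤ 3 * L * L ^ 5 := by gcongr; nlinarith
        _ = 3 * L ^ 6 := by ring
        _ ≤ n := hg3
    exact_mod_cast h2
  refine (failure_le_card_mul (p := p) (n := n) (univ.powersetCard M)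
    (E := fun W G => ∀ S ⊆ W, #S = k → ∃ a ∈ S, ∃ b ∈ S, G.Adj a b)
    (c := Real.exp (-n)) ?_ ?_).trans ?_
  · intro G hG
    push Not at hG
    obtain ⟨W, hW, hno⟩ := hG
    obtain ⟨W', hW', hW'c⟩ := exists_subset_card_eq hW
    exact ⟨W', mem_powersetCard.2 ⟨subset_univ _, hW'c⟩,
      fun S hS hSk => hno S (hS.trans hW') hSk⟩
  · intro W hW
    have hWc := (mem_powersetCard.1 hW).2
    refine (prob_no_independent_subset p h1 (k := k) (hWc ▸ hkM) (y := 1 / (2 * n))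
      (by positivity) (by rw [hWc]; exact hsum k M hk1 hM1)).trans (le_of_eq ?_)
    congr 1
    field_simp
  -- the failure probability `exp (-n)` beats the at most `2 ^ n` sets
  · have h2 : (#((univ : Finset (Fin n)).powersetCard M) : ℝ) ≤ 2 ^ n := by
      rw [card_powersetCard, card_univ, Fintype.card_fin]
      exact_mod_cast Nat.choose_le_two_pow n M
    calc _ ≤ (2 : ℝ) ^ n * Real.exp (-n) := by gcongr
      _ = _ := by
        rw [mul_pow, ← Real.exp_nat_mul]
        congr 2; ring

end WhpProperties

/-! ### The two bounds with a fixed relative error -/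

theorem cycleGraph_ne_bot {m : ℕ} (hm : 2 ≤ m) : SimpleGraph.cycleGraph m ≠ ⊥ := by
  obtain ⟨k, rfl⟩ : ∃ k, m = k + 2 := ⟨m - 2, by omega⟩
  intro h
  have h1 : (SimpleGraph.cycleGraph (k + 2)).Adj 1 0 :=
    SimpleGraph.cycleGraph_adj.2 (Or.inl (by simp))
  rw [h] at h1
  exact h1

/-- The arithmetic of the lower bound: `e` edges, of which `k` are surplus to a forest with `r` roots,
`b` vertices of degree above `L ^ 4`, and independence number `α ≤ (2 + ε) L`. -/
theorem le_card_edges_of_core {n L ε μ e k r b T α : ℝ} {m : ℕ} (hμ : μ = m - 1) (hm : 5 ≤ m) (hL : 1 ≤ L)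
    (hn : 0 < n) (hε : 0 < ε) (hε1 : ε ≤ 1) (hLε : 4 * (95 + 20 * m) ≤ ε * L)
    (hk : k + n = e + r) (hk0 : 0 ≤ k) (hr0 : 0 ≤ r) (he : e ≤ 2 * n) (hb : b * L ^ 4 ≤ 2 * e)
    (hT : T * L ^ 4 ≤ n)
    (hr : r ≤ b + T) (hα0 : 0 ≤ α) (hα : α ≤ (2 + ε) * L)
    (hcard : n ≤ r + (μ * k + α * r) * (2 * α)) :
    n + n / (4 * μ * L) * (1 - ε) ≤ e := by
  have hm' : (5 : ℝ) ≤ m := by exact_mod_cast hm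
  have hμ0 : 0 < μ := by rw [hμ]; linarith
  have hL0 : 0 < L := by linarith
  have hrL : r * L ^ 4 ≤ 5 * n := by
    have : r * L ^ 4 ≤ (b + T) * L ^ 4 := by gcongr
    linarith
  have hα3 : α ≤ 3 * L := hα.trans (by nlinarith)
  have hcard2 : n ≤ r + 2 * ((2 + ε) * L) * (μ * k) + 18 * L ^ 2 * r := by
    have h1 : 2 * α * (μ * k) ≤ 2 * ((2 + ε) * L) * (μ * k) := by gcongr
    have h2 : 2 * (α * α) * r ≤ 2 * (3 * L * (3 * L)) * r := by gcongr
    nlinarith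
  -- both error terms are at most a small multiple of `n / L`
  have hrL2 : (19 * L ^ 2 * r) * L ≤ 95 * n := by
    have h1 : 19 * L ^ 2 * r * L ≤ 19 * (r * L ^ 4) := by
      have : L ^ 3 ≤ L ^ 4 := pow_le_pow_right₀ hL (by norm_num)
      nlinarith [mul_le_mul_of_nonneg_left this hr0]
    linarith
  have hrL3 : (4 * μ * L * r) * L ≤ 20 * m * n := by
    have h1 : L ^ 2 ≤ L ^ 4 := pow_le_pow_right₀ hL (by norm_num)
    calc 4 * μ * L * r * L = 4 * μ * (r * L ^ 2) := by ring
      _ ≤ 4 * μ * (r * L ^ 4) := by gcongr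
      _ ≤ 4 * m * (5 * n) := by gcongr; linarith
      _ = _ := by ring
  have hr1 : r ≤ L ^ 2 * r := le_mul_of_one_le_left hr0 (one_le_pow₀ hL)
  have hX : n - 19 * L ^ 2 * r ≤ (1 + ε / 2) * (4 * μ * L * k) := by nlinarith
  have hsum : 4 * (19 * L ^ 2 * r + 4 * μ * L * r) ≤ ε * n := by
    have h1 : 4 * (19 * L ^ 2 * r + 4 * μ * L * r) * L ≤ (ε * n) * L := by nlinarith
    exact le_of_mul_le_mul_right h1 hL0
  have hY0 : 0 ≤ 4 * μ * L * r := by positivity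
  have hZ0 : 0 ≤ 19 * L ^ 2 * r := by positivity
  have hmain : n * (1 - ε) ≤ 4 * μ * L * (k - r) := by
    by_contra hcon
    push Not at hcon
    -- `(1 + ε / 2) * (1 - ε) ≤ 1 - ε / 2` leaves room for the error terms
    have h1 : (1 + ε / 2) * (4 * μ * L * k) ≤
        (1 + ε / 2) * (n * (1 - ε) + 4 * μ * L * r) := by
      gcongr; nlinarith
    have h2 : ε / 2 * (4 * μ * L * r) ≤ 1 / 2 * (4 * μ * L * r) := by gcongr
    nlinarith [mul_pos hn (mul_pos hε hε), mul_pos hn hε]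
  have : n / (4 * μ * L) * (1 - ε) ≤ k - r := by
    rw [div_mul_eq_mul_div, div_le_iff₀ (by positivity)]
    linarith
  linarith

/-- The lower bound with a fixed relative error. -/
theorem whp_le_sat {p : unitInterval} (h0 : 0 < (p : ℝ)) (h1 : (p : ℝ) < 1) {m : ℕ} (hm : 5 ≤ m)
    {ε : ℝ} (hε : 0 < ε) :
    Whp p fun n G => (n : ℝ) + n / (4 * ((m : ℝ) - 1) * logBase p n) * (1 - ε) ≤
      (sat G (SimpleGraph.cycleGraph m) : ℝ) := by
  set ε' := min ε 1 with hε'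
  have hε'0 : 0 < ε' := lt_min hε one_pos
  have hm' : (5 : ℝ) ≤ m := by exact_mod_cast hm
  refine ((whp_exists_edge_between h0 h1).and (whp_independent_card_le h0 h1 hε'0)).mono ?_
  filter_upwards [eventually_ge_atTop 1, eventually_logBase_ge h0 h1 1,
    eventually_logBase_ge h0 h1 (4 * (95 + 20 * m) / ε'),
    eventually_mul_logBase_pow_le_self h0 h1 (4 + 4 * 3 ^ m) (4 * m + 5)] with n hn hL hLε hg
  rintro G ⟨hedge, hind⟩
  set L := logBase p n with hLdef
  have hL0 : 0 < L := by linarith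
  have hn0 : (0 : ℝ) < n := by exact_mod_cast hn
  have hweak : (n : ℝ) + n / (4 * ((m : ℝ) - 1) * L) * (1 - ε) ≤
      n + n / (4 * ((m : ℝ) - 1) * L) * (1 - ε') := by
    have : 0 ≤ n / (4 * ((m : ℝ) - 1) * L) := div_nonneg hn0.le (by nlinarith)
    have : ε' ≤ ε := min_le_left _ _
    gcongr
  refine hweak.trans ?_
  obtain ⟨H, hH, hcardH⟩ := exists_isSaturatedIn_ncard_eq_sat (SimpleGraph.cycleGraph m)
    (cycleGraph_ne_bot (by omega)) G
  rw [← hcardH]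
  set e := H.edgeSet.ncard with he
  set D := ⌈L ^ 4⌉₊ with hD
  set t := ⌈3 * L⌉₊ with ht
  set α := ⌊(2 + ε') * L⌋₊ with hα
  obtain ⟨k, r, b, hk, hb, hr, hcard⟩ := card_le_of_isSaturatedIn hm hH hind hedge D
  rw [Fintype.card_fin] at hk hcard
  -- below `2 * n` edges there are few vertices of degree above `D`
  rcases le_total (2 * (n : ℝ)) e with hbig | hsmall
  · refine le_trans ?_ hbig
    have h2 : n / (4 * ((m : ℝ) - 1) * L) ≤ n := div_le_self hn0.le (by nlinarith)
    have h3 : 0 ≤ n / (4 * ((m : ℝ) - 1) * L) := div_nonneg hn0.le (by nlinarith)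
    nlinarith
  · have hαle : (α : ℝ) ≤ (2 + ε') * L := Nat.floor_le (by positivity)
    have hDge : L ^ 4 ≤ (D : ℝ) := Nat.le_ceil _
    have hD1 : (D : ℝ) + 1 ≤ 3 * L ^ 4 := by
      have h2 : (D : ℝ) < L ^ 4 + 1 := Nat.ceil_lt_add_one (by positivity)
      have h3 : 1 ≤ L ^ 4 := one_le_pow₀ hL
      linarith
    have ht1 : (t : ℝ) ≤ 4 * L := by
      have h2 : (t : ℝ) < 3 * L + 1 := Nat.ceil_lt_add_one (by positivity)
      linarith
    have hT : ((t : ℝ) + t * (D + 1) ^ m) * L ^ 4 ≤ n := by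
      have h2 : (1 : ℝ) ≤ L ^ (4 * m) := one_le_pow₀ hL
      calc ((t : ℝ) + t * (D + 1) ^ m) * L ^ 4
          ≤ (4 * L * L ^ (4 * m) + 4 * L * (3 * L ^ 4) ^ m) * L ^ 4 := by
            gcongr
            nlinarith
        _ = (4 + 4 * 3 ^ m) * L ^ (4 * m + 5) := by rw [mul_pow, ← pow_mul]; ring
        _ ≤ n := hg
    have hb' : (b : ℝ) * L ^ 4 ≤ 2 * e := by
      calc (b : ℝ) * L ^ 4 ≤ b * D := by gcongr
        _ ≤ 2 * e := by exact_mod_cast hb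
    have hcard' : (n : ℝ) ≤ r + (((m : ℝ) - 1) * k + α * r) * (2 * α) := by
      have h2 : ((m - 1 : ℕ) : ℝ) = (m : ℝ) - 1 := by
        rw [Nat.cast_sub (by omega), Nat.cast_one]
      rw [← h2]
      exact_mod_cast hcard
    have hr' : (r : ℝ) ≤ b + (t + t * (D + 1) ^ m) := by
      rw [← add_assoc]; exact_mod_cast hr
    refine le_card_edges_of_core rfl hm hL hn0 hε'0 (min_le_right _ _) ?_ (by exact_mod_cast hk)
      (Nat.cast_nonneg k) (Nat.cast_nonneg r) hsmall hb' hT hr' (Nat.cast_nonneg α) hαle hcard'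
    rw [div_le_iff₀ hε'0] at hLε
    linarith

/-- The arithmetic of the upper bound: the `n / k` hubs that serve independent sets of
`k ≥ (2 - η) L` leaves dominate all other extra edges. -/
theorem hub_edge_count_le {n L k w η ε : ℝ} {m : ℕ} (hL : 1 ≤ L) (hn : 0 < n) (hε : 0 < ε)
    (hη1 : η ≤ 1 / 2) (hηε : η ≤ ε / 4) (hLε : 4 * (9 + (m : ℝ) ^ 2) ≤ L * ε)
    (hLn : L ≤ n / L ^ 2) (hw : w ≤ 2 * (n / L ^ 2)) (hk : (2 - η) * L ≤ k) :
    n / k + 7 * L + w + (m : ℝ) ^ 2 ≤ n / (2 * L) * (1 + ε) := by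
  have hL0 : 0 < L := by linarith
  have hk0 : 0 < k := lt_of_lt_of_le (mul_pos (by linarith) hL0) hk
  have hmain : n / k ≤ n / (2 * L) * (1 + ε / 2) := by
    rw [div_mul_eq_mul_div, div_le_div_iff₀ hk0 (by positivity)]
    have h2 : 2 * L ≤ (1 + ε / 2) * k := by
      calc 2 * L ≤ (1 + ε / 2) * ((2 - η) * L) := by
            rw [← mul_assoc]
            gcongr
            nlinarith
        _ ≤ _ := by gcongr
    calc n * (2 * L) ≤ n * ((1 + ε / 2) * k) := by gcongr
      _ = _ := by ring
  have hrest : 7 * L + w + (m : ℝ) ^ 2 ≤ n / (2 * L) * (ε / 2) := by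
    have h2 : (m : ℝ) ^ 2 ≤ (n / L ^ 2) * (m : ℝ) ^ 2 :=
      le_mul_of_one_le_left (sq_nonneg _) (hL.trans hLn)
    calc _ ≤ (n / L ^ 2) * (9 + (m : ℝ) ^ 2) := by linarith
      _ ≤ (n / L ^ 2) * (L * ε / 4) := by gcongr; linarith
      _ = _ := by field_simp; ring
  linarith [mul_add (n / (2 * L)) (1 + ε / 2) (ε / 2)]

/-- The upper bound with a fixed relative error. -/
theorem whp_sat_le {p : unitInterval} (h0 : 0 < (p : ℝ)) (h1 : (p : ℝ) < 1) {m : ℕ} (hm : 5 ≤ m)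
    {ε : ℝ} (hε : 0 < ε) :
    Whp p fun n G => (sat G (SimpleGraph.cycleGraph m) : ℝ) ≤
      n + n / (2 * logBase p n) * (1 + ε) := by
  classical
  set η := min (ε / 4) (1 / 2) with hη
  have hη0 : 0 < η := lt_min (by positivity) (by norm_num)
  have hη1 : η ≤ 1 / 2 := min_le_right _ _
  have hηε : η ≤ ε / 4 := min_le_left _ _
  set P := (p : ℝ) ^ m with hP
  have hP0 : 0 < P := by positivity
  have hP1 : P ≤ 1 := pow_le_one₀ h0.le p.2.2
  -- the `n / log² n` vertices set aside as hubs for single vertices; any fixed choice will do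
  set W : ∀ n : ℕ, Finset (Fin n) := fun n =>
    univ.filter fun v : Fin n => (v : ℕ) < ⌈n / logBase p n ^ 2⌉₊ with hW
  have hWcard : ∀ n, #(W n) = min n ⌈n / logBase p n ^ 2⌉₊ := fun n => Fin.card_filter_val_lt
  have hWle : ∀ n, 1 ≤ logBase p n → #(W n) = ⌈n / logBase p n ^ 2⌉₊ := by
    intro n hL
    rw [hWcard, min_eq_right]
    exact Nat.ceil_le.2 (div_le_self (Nat.cast_nonneg n) (one_le_pow₀ hL))
  have hWsqrt : ∀ᶠ n : ℕ in atTop, √(n : ℝ) ≤ #(W n) := by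
    filter_upwards [eventually_ge_atTop 1, eventually_logBase_ge h0 h1 1,
      eventually_mul_logBase_pow_le_self h0 h1 1 4] with n hn hL hg
    have hn0 : (0 : ℝ) < n := by exact_mod_cast hn
    rw [hWle n hL]
    refine le_trans ?_ (Nat.le_ceil _)
    rw [le_div_iff₀ (by positivity)]
    have h2 : logBase p n ^ 2 ≤ √(n : ℝ) := by
      refine Real.le_sqrt_of_sq_le ?_
      calc (logBase p n ^ 2) ^ 2 = 1 * logBase p n ^ 4 := by ring
        _ ≤ (n : ℝ) := hg
    calc √(n : ℝ) * logBase p n ^ 2 ≤ √(n : ℝ) * √(n : ℝ) := by gcongr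
      _ = n := Real.mul_self_sqrt hn0.le
  have huniv : ∀ᶠ n : ℕ in atTop, √(n : ℝ) ≤ #(univ : Finset (Fin n)) := by
    filter_upwards [eventually_ge_atTop 1] with n hn
    rw [card_univ, Fintype.card_fin]
    have hn1 : (1 : ℝ) ≤ n := by exact_mod_cast hn
    exact Real.sqrt_le_iff.2 ⟨by linarith, by nlinarith⟩
  refine ((((whp_exists_edge_between h0 h1).and
    (whp_exists_independent_subset h0 h1 hη0 (by linarith))).and
    (whp_common_neighbors h0 m _ huniv)).and (whp_common_neighbors h0 m W hWsqrt)).mono ?_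
  filter_upwards [eventually_ge_atTop 1, eventually_logBase_ge h0 h1 1,
    eventually_logBase_ge h0 h1 ((24 + 4 * m) / P),
    eventually_logBase_ge h0 h1 (4 * (9 + (m : ℝ) ^ 2) / ε),
    eventually_mul_logBase_pow_le_self h0 h1 1 5] with n hn hL hLP hLε hg
  rintro G ⟨⟨⟨hedge, hind⟩, hcn⟩, hcnW⟩
  set L := logBase p n with hLdef
  have hL0 : 0 < L := by linarith
  have hn0 : (0 : ℝ) < n := by exact_mod_cast hn
  set t := ⌈3 * L⌉₊ with ht
  set M := ⌈n / L ^ 5⌉₊ with hM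
  set k := ⌈(2 - η) * L⌉₊ with hk
  set w := ⌈n / L ^ 2⌉₊ with hw
  have hWn : #(W n) = w := hWle n hL
  rw [div_le_iff₀ hP0] at hLP
  rw [div_le_iff₀ hε] at hLε
  have hpow : ∀ a ≤ 5, L ^ a ≤ n := fun a ha =>
    (pow_le_pow_right₀ hL ha).trans (by linarith)
  have ht1 : (t : ℝ) ≤ 4 * L := by
    have h2 : (t : ℝ) < 3 * L + 1 := Nat.ceil_lt_add_one (by positivity)
    linarith
  have hM1 : (M : ℝ) ≤ 2 * (n / L ^ 5) := by
    have h2 : (M : ℝ) < n / L ^ 5 + 1 := Nat.ceil_lt_add_one (by positivity)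
    have h3 : 1 ≤ n / L ^ 5 := (one_le_div (by positivity)).2 (hpow 5 le_rfl)
    linarith
  have hw1 : (w : ℝ) ≤ 2 * (n / L ^ 2) := by
    have h2 : (w : ℝ) < n / L ^ 2 + 1 := Nat.ceil_lt_add_one (by positivity)
    have h3 : 1 ≤ n / L ^ 2 := (one_le_div (by positivity)).2 (hpow 2 (by norm_num))
    linarith
  have hw2 : n / L ^ 2 ≤ (w : ℝ) := Nat.le_ceil _
  have hkge : (2 - η) * L ≤ (k : ℝ) := Nat.le_ceil _
  have hkL : L ≤ (k : ℝ) := by nlinarith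
  have hk0 : 0 < k := by
    have : (0 : ℝ) < k := by linarith
    exact_mod_cast this
  have hm0 : (0 : ℝ) ≤ m := Nat.cast_nonneg m
  have hdiv : ((n / k : ℕ) : ℝ) ≤ n / k := Nat.cast_div_le
  have hL2 : L ^ 2 * L = L ^ 3 := by ring
  have hLn2 : L ≤ n / L ^ 2 := by
    rw [le_div_iff₀ (by positivity), mul_comm, hL2]; exact hpow 3 (by norm_num)
  have hLn4 : L ≤ n / L ^ 4 := by
    rw [le_div_iff₀ (by positivity), ← pow_succ']; exact hpow 5 le_rfl
  have h42 : n / L ^ 4 * L ^ 2 = n / L ^ 2 := by field_simp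
  have h10 : n / L * L = n := by field_simp
  have hn2le : n / L ^ 2 ≤ n / L := div_le_div_of_nonneg_left hn0.le hL0 (le_self_pow₀ hL (by norm_num))
  have hr₀ : ((t * M + t : ℕ) : ℝ) ≤ 12 * (n / L ^ 4) := by
    push_cast
    calc (t : ℝ) * M + t ≤ 4 * L * (2 * (n / L ^ 5)) + 4 * L := by gcongr
      _ = 8 * (n / L ^ 4) + 4 * L := by field_simp; ring
      _ ≤ _ := by linarith
  have hN : ((n / k + 1 + t + 2 : ℕ) : ℝ) ≤ n / k + 7 * L := by
    push_cast
    linarith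
  have hnk : (n : ℝ) / k ≤ n / L := div_le_div_of_nonneg_left hn0.le hL0 hkL
  have key : (sat G (SimpleGraph.cycleGraph m)) ≤
      Fintype.card (Fin n) + ((n / k + 1 + t + 2) + #(W n)) + m ^ 2 := by
    refine sat_le_of_expansion (t := t) (M := M) (k := k) (r₀ := t * M + t) (i := n / k + 1) hm
      hedge hind le_rfl ?_ (Nat.le_add_right _ _) (Nat.le_add_left _ _) ?_ ?_
    · rw [Fintype.card_fin, mul_comm]
      exact (Nat.lt_mul_div_succ n hk0).le.trans (Nat.le_add_right _ _)
    · intro T hT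
      have h2 := hcn T hT
      rw [card_univ, Fintype.card_fin] at h2
      have h3 : ((n / k + 1 + t + 2 + #(W n) + m : ℕ) : ℝ) ≤ ((n : ℝ) - m) * P / 2 := by
        rw [Nat.cast_add, Nat.cast_add, hWn]
        have h4 : (n / L) * (24 + 4 * m) ≤ n * P := by
          calc (n / L) * (24 + 4 * m) ≤ (n / L) * (L * P) := by gcongr
            _ = n * P := by rw [← mul_assoc, h10]
        have h5 : 1 ≤ n / L := (one_le_div hL0).2 (by simpa using hpow 1 (by norm_num))
        have h6 : (m : ℝ) ≤ m * (n / L) := le_mul_of_one_le_right hm0 h5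
        have h7 : m * P ≤ m := mul_le_of_le_one_right hm0 hP1
        linarith
      refine le_trans ?_ (Set.ncard_coe_finset _).le
      rw [coe_filter]
      exact_mod_cast h3.trans h2
    · intro T hT
      have h2 := hcnW T hT
      rw [hWn] at h2
      have h3 : ((t * M + t + m : ℕ) : ℝ) ≤ ((w : ℝ) - m) * P / 2 := by
        rw [Nat.cast_add]
        have h4 : (n / L ^ 4) * (24 + 4 * m) ≤ n / L ^ 2 * P := by
          calc (n / L ^ 4) * (24 + 4 * m) ≤ (n / L ^ 4) * (L * P) := by gcongr
            _ ≤ (n / L ^ 4) * (L ^ 2 * P) := by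
              gcongr; exact le_self_pow₀ hL (by norm_num)
            _ = n / L ^ 2 * P := by rw [← mul_assoc, h42]
        have h5 : 1 ≤ n / L ^ 4 := hL.trans hLn4
        have h6 : n / L ^ 2 * P ≤ w * P := by gcongr
        have h7 : (m : ℝ) ≤ m * (n / L ^ 4) := le_mul_of_one_le_right hm0 h5
        have h8 : m * P ≤ m := mul_le_of_le_one_right hm0 hP1
        linarith
      refine le_trans ?_ (Set.ncard_coe_finset _).le
      rw [coe_filter]
      exact_mod_cast h3.trans h2
  rw [Fintype.card_fin, hWn] at key
  have key' : (sat G (SimpleGraph.cycleGraph m) : ℝ) ≤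
      n + (((n / k + 1 + t + 2 : ℕ) : ℝ) + w) + (m : ℝ) ^ 2 := by exact_mod_cast key
  linarith [hub_edge_count_le (m := m) hL hn0 hε hη1 hηε hLε hLn2 hw1 hkge]

end RandomCycleSaturation

open RandomCycleSaturation in
theorem theorem1 (p : ℝ) (hp : p ∈ Set.Ioo (0 : ℝ) 1) (m : ℕ) (hm : 5 ≤ m) :
    (∃ δ₁ δ₂ : ℕ → ℝ, Tendsto δ₁ atTop (𝓝 0) ∧ Tendsto δ₂ atTop (𝓝 0) ∧
      RandomCycleSaturation.Whp ⟨p, Set.Ioo_subset_Icc_self hp⟩ (fun n G =>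
        (n : ℝ) + (n : ℝ) / (4 * ((m : ℝ) - 1) * Real.logb (1 / (1 - p)) n) * (1 - δ₁ n)
            ≤ (RandomCycleSaturation.sat G (SimpleGraph.cycleGraph m) : ℝ) ∧
        (RandomCycleSaturation.sat G (SimpleGraph.cycleGraph m) : ℝ)
            ≤ (n : ℝ) + (n : ℝ) / (2 * Real.logb (1 / (1 - p)) n) * (1 + δ₂ n))) ∧
    (∃ c C : ℝ, 0 < c ∧ 0 < C ∧
      RandomCycleSaturation.Whp ⟨p, Set.Ioo_subset_Icc_self hp⟩ (fun n G =>
        (n : ℝ) + c * ((n : ℝ) / Real.log n)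
            ≤ (RandomCycleSaturation.sat G (SimpleGraph.cycleGraph m) : ℝ) ∧
        (RandomCycleSaturation.sat G (SimpleGraph.cycleGraph m) : ℝ)
            ≤ (n : ℝ) + C * ((n : ℝ) / Real.log n))) := by
  set P : unitInterval := ⟨p, Set.Ioo_subset_Icc_self hp⟩ with hP
  have h0 : 0 < (P : ℝ) := hp.1
  have h1 : (P : ℝ) < 1 := hp.2
  constructor
  · obtain ⟨δ₁, hδ₁, hw₁⟩ := exists_tendsto_zero_whp fun ε hε => whp_le_sat h0 h1 hm hε
    obtain ⟨δ₂, hδ₂, hw₂⟩ := exists_tendsto_zero_whp fun ε hε => whp_sat_le h0 h1 hm hε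
    exact ⟨δ₁, δ₂, hδ₁, hδ₂, hw₁.and hw₂⟩
  · have hm' : (5 : ℝ) ≤ m := by exact_mod_cast hm
    have hb : 0 < Real.log (1 / (1 - p)) := Real.log_pos (one_lt_base hp.1 hp.2)
    refine ⟨Real.log (1 / (1 - p)) / (8 * ((m : ℝ) - 1)), 3 / 4 * Real.log (1 / (1 - p)),
      div_pos hb (by linarith), by positivity, ?_⟩
    refine ((whp_le_sat h0 h1 hm one_half_pos).and (whp_sat_le h0 h1 hm one_half_pos)).mono ?_
    filter_upwards [eventually_ge_atTop 2] with n hn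
    rintro G ⟨hlow, hup⟩
    have hlog : 0 < Real.log n := Real.log_pos (by exact_mod_cast hn)
    have hm1 : (m : ℝ) - 1 ≠ 0 := by linarith
    have hL : logBase P n = Real.log n / Real.log (1 / (1 - p)) := rfl
    rw [hL] at hlow hup
    constructor
    · refine le_trans (le_of_eq ?_) hlow
      field_simp
      ring
    · refine hup.trans (le_of_eq ?_)
      field_simp
      ring
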